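/- Let $S^1\subset\mathbb R^2$ be the unit circle with arc length measure $\sigma$. For $f\in L^2(S^1)=L^2(S^1,\sigma;\mathbb C)$ put $\widehat{f\sigma}(\xi)=\int_{S^1}e^{-i\xi\cdot x}f(x)\,d\sigma(x)$, $\xi\in\mathbb R^2$, and let $$\mathcal R=\sup\{\|\widehat{f\sigma}\|_{L^6(\mathbb R^2)}:\ f\in L^2(S^1),\ \|f\|_{L^2(S^1)}=1\}$$ be the optimal constant in the Tomas–Stein inequality $\|\widehat{f\sigma}\|_{L^6(\mathbb R^2)}\le\mathcal R\|f\|_{L^2(S^1)}$. An extremizer is an $f\in L^2(S^1)$, $f\neq0$, for which equality holds; an extremizing sequence is a sequence $\{f_\nu\}\subset L^2(S^1)$ with $\|f_\nu\|_2=1$ for all $\nu$ and $\|\widehat{f_\nu\sigma}\|_{L^6(\mathbb R^2)}\to\mathcal R$. For $z\in S^1$ and $r\in(0,1]$, the cap $\mathcal C(z,r)$ is the set of $y\in S^1$ with $y\cdot z>0$ and $|y-(y\cdot z)z|<r$. Let $K<\infty$ and let $\Theta:[1,\infty)\to(0,\infty)$ satisfy $\Theta(R)\to0$ as $R\to\infty$.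 A function $g\in L^2(S^1)$ is upper normalized with respect to $\mathcal C(z,r)$, with constants $(K,\Theta)$, if $\|g\|_2\le K$ and, for all $R\ge1$, $$\int_{|g|>Rr^{-1/2}}|g|^2\,d\sigma\le\Theta(R),\qquad \int_{|x-z|\ge Rr}|g(x)|^2\,d\sigma(x)\le\Theta(R).$$ A function $h$ that is even (i.e. $\overline{h(-x)}=h(x)$ for a.e. $x$) is upper even-normalized with respect to $\mathcal C(z,r)$, with constants $(K,\Theta)$, if $h(x)=h_+(x)+h_+(-x)$ for a.e. $x$ for some $h_+$ that is upper normalized with respect to $\mathcal C(z,r)$ with constants $(K,\Theta)$. **Proposition.** Let $\{f_\nu\}$ be an extremizing sequence with $|f_\nu(-x)|=|f_\nu(x)|$ for a.e. $x\in S^1$ and all $\nu$. Suppose that there are $z_\nu\in S^1$, $r_\nu\in(0,1]$, and $K,\Theta$ as above independent of $\nu$, such that each $|f_\nu|$ is upper even-normalized with respect to $\mathcal C(z_\nu,r_\nu)$ with constants $(K,\Theta)$. Then $$\inf_\nu r_\nu>0,$$ and an extremizer is obtained from the sequence: there is a subsequence along which $|f_\nu|$ converges in $L^2(S^1)$ to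 an extremizer. -/

import Mathlib

open MeasureTheory Filter Topology
open scoped NNReal ENNReal ComplexConjugate

noncomputable section

namespace TomasStein

/-- The Euclidean plane. -/
abbrev Plane : Type := EuclideanSpace ℝ (Fin 2)

/-- The unit circle `S¹`; its metric is the chordal (Euclidean) distance, `-x` is the antipode. -/
abbrev Circle1 : Type := Metric.sphere (0 : Plane) 1

/-- Surface measure (arc length, of total mass `2π`) on `S¹`. -/
def sigma : Measure Circle1 := (volume : Measure Plane).toSphere

/-- The Fourier transform of the measure `f σ`: `ξ ↦ ∫ exp(-i ξ·x) f(x) dσ(x)`. -/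
def extension (f : Circle1 → ℂ) (ξ : Plane) : ℂ :=
  ∫ x : Circle1, Complex.exp (-Complex.I * ((inner ℝ ξ (x : Plane) : ℝ) : ℂ)) * f x ∂sigma

/-- The optimal constant: the supremum of the `L⁶(ℝ²)` norm of the Fourier transform of `f σ` over
all complex-valued `f ∈ L²(S¹)` of norm one. -/
def optimalConstant : ℝ≥0∞ :=
  ⨆ (f : Circle1 → ℂ) (_ : MemLp f 2 sigma) (_ : eLpNorm f 2 sigma = 1),
    eLpNorm (extension f) 6 volume

/-- Extremizers: nonzero elements of `L²(S¹)` attaining equality in the inequality. -/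
structure IsExtremizer (f : Circle1 → ℂ) : Prop where
  memLp : MemLp f 2 sigma
  ne_zero : ¬ f =ᵐ[sigma] 0
  eq : eLpNorm (extension f) 6 volume = optimalConstant * eLpNorm f 2 sigma

/-- Extremizing sequences. -/
structure IsExtremizingSeq (f : ℕ → Circle1 → ℂ) : Prop where
  memLp : ∀ ν, MemLp (f ν) 2 sigma
  norm_eq_one : ∀ ν, eLpNorm (f ν) 2 sigma = 1
  tendsto : Tendsto (fun ν => eLpNorm (extension (f ν)) 6 volume) atTop (𝓝 optimalConstant)

/-- A cap, given by its center `z ∈ S¹` and its radius `r ∈ (0, 1]`. -/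
structure Cap where
  center : Circle1
  radius : ℝ
  radius_pos : 0 < radius
  radius_le_one : radius ≤ 1

/-- The points of the cap: those `y` in the open hemisphere around `z` whose orthogonal projection
to the line orthogonal to `z` has length less than `r`. -/
def Cap.toSet (c : Cap) : Set Circle1 :=
  {y | 0 < inner ℝ (y : Plane) (c.center : Plane) ∧
    ‖(y : Plane) - inner ℝ (y : Plane) (c.center : Plane) • (c.center : Plane)‖ < c.radius}

/-- `f` is upper normalized with respect to the cap `c`, with norm bound `K` and tail function `Θ`
(only the values of `Θ` on `[1, ∞)` matter). -/
structure UpperNormalized (K : ℝ≥0) (Θ : ℝ → ℝ) (c : Cap) (f : Circle1 → ℂ) : Prop where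
  memLp : MemLp f 2 sigma
  norm_le : eLpNorm f 2 sigma ≤ K
  height : ∀ R : ℝ, 1 ≤ R →
    ∫ x in {x | R * c.radius ^ (-(1 / 2) : ℝ) < ‖f x‖}, ‖f x‖ ^ 2 ∂sigma ≤ Θ R
  tail : ∀ R : ℝ, 1 ≤ R →
    ∫ x in {x | R * c.radius ≤ dist x c.center}, ‖f x‖ ^ 2 ∂sigma ≤ Θ R

/-- A complex function on `S¹` is even if the conjugate of `f(-x)` equals `f(x)` almost everywhere;
for real-valued `f` this says `f(-x) = f(x)`. -/
def IsEven (f : Circle1 → ℂ) : Prop := ∀ᵐ x ∂sigma, conj (f (-x)) = f x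

/-- `f` is upper even-normalized: it is even, and `f(x) = f₊(x) + f₊(-x)` with `f₊` upper
normalized. -/
def UpperEvenNormalized (K : ℝ≥0) (Θ : ℝ → ℝ) (c : Cap) (f : Circle1 → ℂ) : Prop :=
  IsEven f ∧ ∃ g : Circle1 → ℂ, UpperNormalized K Θ c g ∧ ∀ᵐ x ∂sigma, f x = g x + g (-x)

/-- The modulus `|f|`, as a complex-valued function. -/
def modulus (f : Circle1 → ℂ) : Circle1 → ℂ := fun x => ((‖f x‖ : ℝ) : ℂ)

end TomasStein

end

/-!
The sixth power of the `L⁶` norm of the Fourier transform of `f σ` is a six-fold integral of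
`f ⊗ f ⊗ f ⊗ f̄ ⊗ f̄ ⊗ f̄` against a positive kernel, the limit of the Gaussians
`gaussKernel ε (x₁ + x₂ + x₃ - y₁ - y₂ - y₃)`. Hence passing from `f` to `|f|` does not decrease the
norm (`lintegral_extension_pow_le_modulus`), so that the moduli of an extremizing sequence are again
extremizing. Schur's test reduces the extension inequality on an arc to a bound for the threefold
convolution of arc length on that arc. On short arcs this convolution has a density bounded by
`convConst`, which exceeds the value `2π / √3` for the parabola by a factor `10 / 9` only
(`lintegral_arc_triple_le`). A covering of the circle by short arcs then makes the optimal constant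
finite (`optimalConstant_ne_top`).

*The caps do not shrink.* If they did, `|f|` would be, up to a small `L²` error, of the form
`p(x) + p(-x)` with `p` carried by a short arc. The extension of such a function is `P + conj P`, with
`P` the extension of `p`. In the binomial expansion of `(P + conj P)⁶` all terms but `20 |P|⁶` have
spectrum away from the origin and integrate to zero (`lintegral_add_conj_pow_le`), while
`‖p‖₂² ≤ 1 / 2`, so the sixth power of the norm is at most `20 / 8 · arcConst`. Constant functions
do strictly better, as `J₀(r) ≥ 1 - r² / 4` shows (`five_halves_arcConst_lt`).

*Compactness.* With caps of size bounded from below, the squares `|f|²` are equi-integrable, so the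
integrals of the `|f|` are bounded from below and weak limits of the `|f|` are not zero
(`exists_lower_bound_extension_zero`). Let `a` be the squared norm of a weak limit. As
extensions converge pointwise, the Brezis–Lieb lemma splits the sixth power of the `L⁶` norm, and
the extension inequality gives `1 ≤ a³ + (1 - a)³` with `0 < a ≤ 1`. So `a = 1`, the convergence is
strong (`tendsto_norm_sub_of_weak`), and the limit is an extremizer.
-/

noncomputable section
namespace TomasStein

/-! ### Arc length in the angle variable -/

/-- The point of the circle at angle `θ`, for an identification `L` of `ℂ` with the plane. -/
def circlePoint (L : ℂ ≃ₗᵢ[ℝ] Plane) (θ : ℝ) : Circle1 :=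
  ⟨L (Complex.exp (θ * Complex.I)), by
    simp [Complex.norm_exp_ofReal_mul_I]⟩

lemma continuous_circlePoint (L : ℂ ≃ₗᵢ[ℝ] Plane) : Continuous (circlePoint L) := by
  unfold circlePoint
  fun_prop

lemma measurable_circlePoint (L : ℂ ≃ₗᵢ[ℝ] Plane) : Measurable (circlePoint L) :=
  (continuous_circlePoint L).measurable

lemma coe_circlePoint (L : ℂ ≃ₗᵢ[ℝ] Plane) (θ : ℝ) :
    (circlePoint L θ : Plane) = L (Complex.exp (θ * Complex.I)) := rfl

/-- The standard isometry `x + iy ↦ (x, y)`. -/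
def planeIso : ℂ ≃ₗᵢ[ℝ] Plane := Complex.orthonormalBasisOneI.repr

lemma lintegral_plane_polar_angle (L : ℂ ≃ₗᵢ[ℝ] Plane) {g : Plane → ℝ≥0∞} (hg : Measurable g) :
    ∫⁻ v, g v = ∫⁻ r in Set.Ioi (0 : ℝ), ENNReal.ofReal r *
      ∫⁻ θ in Set.Ioo (-Real.pi) Real.pi, g (r • (circlePoint L θ : Plane)) := by
  have hL : MeasurePreserving L volume volume := L.measurePreserving
  rw [← hL.lintegral_comp hg, ← Complex.lintegral_comp_polarCoord_symm]
  have ht : polarCoord.target = Set.Ioi (0 : ℝ) ×ˢ Set.Ioo (-Real.pi) Real.pi := rfl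
  have key : ∀ p : ℝ × ℝ, g (L (Complex.polarCoord.symm p)) =
      g (p.1 • (circlePoint L p.2 : Plane)) := by
    intro p
    rw [coe_circlePoint, ← map_smul, Complex.polarCoord_symm_apply, Complex.exp_mul_I]
    congr 2
    simp [mul_add]
  have hm : Measurable fun p : ℝ × ℝ => g (p.1 • (circlePoint L p.2 : Plane)) := by
    apply hg.comp
    have := measurable_circlePoint L
    fun_prop
  simp_rw [key, ht, smul_eq_mul]
  rw [Measure.volume_eq_prod, ← Measure.prod_restrict, lintegral_prod]
  · refine lintegral_congr fun r => ?_
    exact lintegral_const_mul (ENNReal.ofReal r)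
      (f := fun θ => g (r • (circlePoint L θ : Plane))) (hm.comp measurable_prodMk_left)
  · exact ((ENNReal.measurable_ofReal.comp measurable_fst).mul hm).aemeasurable

lemma lintegral_Ioo_zero_one_ofReal : ∫⁻ r in Set.Ioo (0 : ℝ) 1, ENNReal.ofReal r = 2⁻¹ := by
  have h : ∫ r in Set.Ioo (0 : ℝ) 1, r = 1 / 2 := by
    rw [← integral_Ioc_eq_integral_Ioo, ← intervalIntegral.integral_of_le zero_le_one, integral_id]
    norm_num
  rw [← ofReal_integral_eq_lintegral_ofReal, h]
  · rw [one_div, ENNReal.ofReal_inv_of_pos two_pos]; simp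
  · exact (continuous_id.integrableOn_Icc (a := (0 : ℝ)) (b := 1)).mono_set Set.Ioo_subset_Icc_self
  · filter_upwards [ae_restrict_mem measurableSet_Ioo] with x hx using hx.1.le

open scoped Pointwise in
/-- Arc length on the circle is Lebesgue measure in the angle. -/
theorem map_circlePoint (L : ℂ ≃ₗᵢ[ℝ] Plane) :
    Measure.map (circlePoint L) (volume.restrict (Set.Ioo (-Real.pi) Real.pi)) = sigma := by
  symm
  ext s hs
  rw [Measure.map_apply (measurable_circlePoint L) hs, sigma, Measure.toSphere_apply' _ hs]
  set S : Set Plane := Set.Ioo (0 : ℝ) 1 • ((↑) '' s : Set Plane) with hS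
  -- The cone over `s` inside the unit disc, in polar coordinates.
  have hmem : ∀ r : ℝ, 0 < r → ∀ x : Circle1, r • (x : Plane) ∈ S ↔ r < 1 ∧ x ∈ s := by
    intro r hr x
    constructor
    · rintro ⟨t, ht, _, ⟨y, hy, rfl⟩, hty⟩
      have h1 : t = r := by
        have := congrArg norm hty
        simpa [norm_smul, abs_of_pos hr, abs_of_pos ht.1] using this
      subst h1
      have h2 : (y : Plane) = x := smul_right_injective _ hr.ne' hty
      exact ⟨ht.2, by rwa [← Subtype.ext h2]⟩
    · rintro ⟨h1, h2⟩
      exact ⟨r, ⟨hr, h1⟩, x, ⟨x, h2, rfl⟩, rfl⟩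
  have hSm : MeasurableSet S := by
    have h : S = ((↑) '' (homeomorphUnitSphereProd Plane ⁻¹'
        s ×ˢ Set.Iio (⟨1, Set.mem_Ioi.2 zero_lt_one⟩ : Set.Ioi (0 : ℝ)))) := by
      rw [hS, ← Set.image2_smul, Set.image2_image_right, ← Homeomorph.image_symm, Set.image_image,
        ← Set.image_subtype_val_Ioi_Iio ⟨1, Set.mem_Ioi.2 zero_lt_one⟩, Set.image2_image_left, Set.image2_swap,
        ← Set.image_prod]
      rfl
    rw [h]
    refine (MeasurableEmbedding.subtype_coe (measurableSet_singleton _).compl).measurableSet_image' ?_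
    exact (homeomorphUnitSphereProd Plane).measurable (hs.prod measurableSet_Iio)
  have hfin : Module.finrank ℝ Plane = 2 := by simp
  rw [hfin, ← lintegral_indicator_one hSm,
    lintegral_plane_polar_angle L (measurable_one.indicator hSm)]
  have h1 : ∀ r ∈ Set.Ioi (0 : ℝ), ENNReal.ofReal r *
      ∫⁻ θ in Set.Ioo (-Real.pi) Real.pi, S.indicator 1 (r • (circlePoint L θ : Plane)) =
      (Set.Iio 1).indicator ENNReal.ofReal r *
        volume.restrict (Set.Ioo (-Real.pi) Real.pi) (circlePoint L ⁻¹' s) := by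
    intro r hr
    have h2 : ∀ θ, S.indicator (1 : Plane → ℝ≥0∞) (r • (circlePoint L θ : Plane)) =
        (Set.Iio 1).indicator 1 r * (circlePoint L ⁻¹' s).indicator 1 θ := by
      intro θ
      have := hmem r hr (circlePoint L θ)
      by_cases h3 : r < 1 <;> by_cases h4 : circlePoint L θ ∈ s <;>
        simp [Set.indicator, this, h3, h4]
    simp_rw [h2]
    rw [lintegral_const_mul _ (measurable_one.indicator (measurable_circlePoint L hs)),
      lintegral_indicator_one (measurable_circlePoint L hs)]
    by_cases h3 : r < 1 <;> simp [Set.indicator, h3]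
  rw [setLIntegral_congr_fun measurableSet_Ioi h1, lintegral_mul_const]
  · rw [lintegral_indicator measurableSet_Iio, Measure.restrict_restrict measurableSet_Iio,
      Set.Iio_inter_Ioi, lintegral_Ioo_zero_one_ofReal, ← mul_assoc]
    rw [Nat.cast_ofNat, ENNReal.mul_inv_cancel two_ne_zero ENNReal.ofNat_ne_top, one_mul]
  · exact ENNReal.measurable_ofReal.indicator measurableSet_Iio

lemma lintegral_sigma_eq (L : ℂ ≃ₗᵢ[ℝ] Plane) {g : Circle1 → ℝ≥0∞} (hg : Measurable g) :
    ∫⁻ x, g x ∂sigma = ∫⁻ θ in Set.Ioo (-Real.pi) Real.pi, g (circlePoint L θ) := by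
  rw [← map_circlePoint L, lintegral_map hg (measurable_circlePoint L)]

/-- Polar coordinates in the plane. -/
lemma lintegral_plane_polar {g : Plane → ℝ≥0∞} (hg : Measurable g) :
    ∫⁻ v, g v = ∫⁻ r in Set.Ioi (0 : ℝ), ENNReal.ofReal r * ∫⁻ x, g (r • (x : Plane)) ∂sigma := by
  rw [lintegral_plane_polar_angle planeIso hg]
  refine lintegral_congr fun r => ?_
  rw [lintegral_sigma_eq planeIso]
  exact hg.comp (by fun_prop)

instance : IsFiniteMeasure sigma := by unfold sigma; infer_instance

lemma sigma_univ : sigma Set.univ = ENNReal.ofReal (2 * Real.pi) := by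
  rw [← map_circlePoint planeIso, Measure.map_apply (measurable_circlePoint _) .univ]
  simp only [Set.preimage_univ, Measure.restrict_apply_univ, Real.volume_Ioo]
  congr 1; ring

/-- Arc length is invariant under the linear isometries of the plane. -/
lemma map_sigma_isometry (T : Plane ≃ₗᵢ[ℝ] Plane) (S : Circle1 → Circle1)
    (hS : ∀ x, (S x : Plane) = T x) : MeasurePreserving S sigma sigma := by
  have hc : Continuous S := by
    refine Continuous.subtype_mk (f := fun x => (S x : Plane)) ?_ (fun x => (S x).2)
    simp_rw [hS]; fun_prop
  refine ⟨hc.measurable, ?_⟩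
  conv_lhs => rw [← map_circlePoint planeIso]
  rw [← map_circlePoint (planeIso.trans T), Measure.map_map hc.measurable (measurable_circlePoint _)]
  congr 1
  ext1 θ
  exact Subtype.ext (by simp [hS, coe_circlePoint])

lemma measurePreserving_neg_sigma : MeasurePreserving (fun x : Circle1 => -x) sigma sigma :=
  map_sigma_isometry (LinearIsometryEquiv.neg ℝ) _ (fun x => by simp)

lemma exists_iso_mul {u : ℂ} (hu : ‖u‖ = 1) : ∃ T : ℂ ≃ₗᵢ[ℝ] ℂ, ∀ w, T w = u * w := by
  obtain ⟨t, rfl⟩ := (Complex.norm_eq_one_iff u).1 hu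
  exact ⟨rotation (Circle.exp t), fun w => by rw [rotation_apply, Circle.coe_exp]⟩

lemma exists_iso_apply_one (z : Circle1) : ∃ L : ℂ ≃ₗᵢ[ℝ] Plane, L 1 = z := by
  have hz : ‖planeIso.symm (z : Plane)‖ = 1 := by
    rw [LinearIsometryEquiv.norm_map]; simp
  obtain ⟨T, hT⟩ := exists_iso_mul hz
  exact ⟨T.trans planeIso, by simp [hT]⟩

/-- Spherical means only depend on the modulus of the centre. -/
lemma lintegral_circlePoint_mul (L : ℂ ≃ₗᵢ[ℝ] Plane) (A : ℂ) {g : Plane → ℝ≥0∞}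
    (hg : Measurable g) :
    ∫⁻ θ in Set.Ioo (-Real.pi) Real.pi, g (L (Complex.exp (θ * Complex.I) * A)) =
      ∫⁻ x, g (‖A‖ • (x : Plane)) ∂sigma := by
  have hu : ‖Complex.exp (A.arg * Complex.I)‖ = 1 := Complex.norm_exp_ofReal_mul_I _
  obtain ⟨T, hT⟩ := exists_iso_mul hu
  have hm : Measurable fun x : Circle1 => g (‖A‖ • (x : Plane)) := hg.comp (by fun_prop)
  rw [lintegral_sigma_eq (T.trans L) hm]
  refine lintegral_congr fun θ => ?_
  congr 1
  rw [coe_circlePoint, ← map_smul]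
  simp only [LinearIsometryEquiv.trans_apply, hT]
  congr 1
  conv_lhs => rw [← Complex.norm_mul_exp_arg_mul_I A]
  rw [Complex.real_smul]
  ring

/-! ### The threefold convolution of arc length on a short arc -/

/-- In the coordinates `a = √3 x + y`, `b = √3 x - y` the form `a² + b² + (a - b)²` becomes
`6 (x² + y²)`. -/
lemma lintegral_prod_linear_change {F : ℝ × ℝ → ℝ≥0∞} (hF : Measurable F) :
    ∫⁻ p, F p = ENNReal.ofReal (2 * √3) *
      ∫⁻ p : ℝ × ℝ, F (√3 * p.1 + p.2, √3 * p.1 - p.2) := by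
  set T : ℝ × ℝ →ₗ[ℝ] ℝ × ℝ :=
    Matrix.toLin (Module.Basis.finTwoProd ℝ) (Module.Basis.finTwoProd ℝ) !![√3, 1; √3, -1] with hT
  have hdet : LinearMap.det T = -(2 * √3) := by
    rw [hT, LinearMap.det_toLin, Matrix.det_fin_two]; simp; ring
  have h3 : (0 : ℝ) < 2 * √3 := by positivity
  have hTp : ∀ p : ℝ × ℝ, T p = (√3 * p.1 + p.2, √3 * p.1 - p.2) := by
    intro p
    rw [hT, Matrix.toLin_finTwoProd_apply]
    ext <;> simp; ring
  have hmap := Measure.map_linearMap_addHaar_eq_smul_addHaar (volume : Measure (ℝ × ℝ))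
    (f := T) (by rw [hdet]; exact neg_ne_zero.2 h3.ne')
  have hTm : Measurable T := T.continuous_of_finiteDimensional.measurable
  have := lintegral_map (μ := volume) hF hTm
  rw [hmap, lintegral_smul_measure, hdet] at this
  simp_rw [hTp] at this
  rw [← this, smul_eq_mul, ← mul_assoc, ← ENNReal.ofReal_mul h3.le, abs_inv, abs_neg,
    abs_of_pos h3, mul_inv_cancel₀ h3.ne', ENNReal.ofReal_one, one_mul]

lemma mul_sin_lower_bound {α r : ℝ} (hα : |α| ≤ 2) (hr : 0 < r) (hr' : r ≤ 1 / 4) :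
    9 / 10 * (α ^ 2 * r) ≤ α * Real.sin (α * r) := by
  have key : ∀ β : ℝ, 0 ≤ β → β ≤ 2 → 9 / 10 * (β ^ 2 * r) ≤ β * Real.sin (β * r) := by
    intro β h0 h2
    rcases h0.eq_or_lt with rfl | h0
    · simp
    have hx : 0 < β * r := by positivity
    have hx1 : β * r ≤ 1 / 2 := by nlinarith
    have := Real.sin_gt_sub_cube hx
    have h4 : (β * r) ^ 3 / 6 ≤ β * r * (1 / 10) := by
      have : (β * r) ^ 2 ≤ (1 / 2) ^ 2 := by gcongr
      nlinarith
    have h5 : 9 / 10 * (β * r) ≤ Real.sin (β * r) := by linarith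
    nlinarith
  rcases le_total 0 α with h | h
  · exact key α h (le_trans (le_abs_self α) hα)
  · have := key (-α) (by linarith) (le_trans (neg_le_abs α) hα)
    rwa [neg_mul α r, Real.sin_neg, neg_mul_neg, neg_sq] at this

/-- Along a ray in the symmetric coordinates, the modulus of the sum of three unit vectors is a
good radial variable: its square has derivative at most `-(9/10) * 12 r`. -/
lemma lintegral_ray_le {Γ : ℝ → ℝ≥0∞} {α β : ℝ} (h1 : |α| ≤ 2) (h2 : |β| ≤ 2)
    (h3 : |α - β| ≤ 2) (h6 : α ^ 2 + β ^ 2 + (α - β) ^ 2 = 6) :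
    ∫⁻ r in Set.Ioo (0 : ℝ) (1 / 4), ENNReal.ofReal r *
        Γ ‖1 + Complex.exp ((α * r : ℝ) * Complex.I) + Complex.exp ((β * r : ℝ) * Complex.I)‖ ≤
      ENNReal.ofReal (5 / 27) * ∫⁻ r in Set.Ioi (0 : ℝ), ENNReal.ofReal r * Γ r := by
  set q : ℝ → ℝ := fun r => 3 + 2 * Real.cos (α * r) + 2 * Real.cos (β * r) +
    2 * Real.cos ((α - β) * r) with hq
  have hnorm : ∀ r : ℝ, ‖1 + Complex.exp ((α * r : ℝ) * Complex.I) +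
      Complex.exp ((β * r : ℝ) * Complex.I)‖ = √(q r) := by
    intro r
    rw [Complex.norm_def, Complex.normSq_apply]
    congr 1
    simp only [Complex.add_re, Complex.one_re, Complex.exp_ofReal_mul_I_re, Complex.add_im,
      Complex.one_im, Complex.exp_ofReal_mul_I_im, hq, sub_mul, Real.cos_sub]
    linear_combination Real.sin_sq_add_cos_sq (α * r) + Real.sin_sq_add_cos_sq (β * r)
  set q' : ℝ → ℝ := fun r => -(2 * (α * Real.sin (α * r)) + 2 * (β * Real.sin (β * r)) +
    2 * ((α - β) * Real.sin ((α - β) * r))) with hq'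
  have hcosd : ∀ c r : ℝ, HasDerivAt (fun r => 2 * Real.cos (c * r))
      (-(2 * (c * Real.sin (c * r)))) r := by
    intro c r
    have := (((hasDerivAt_id r).const_mul c).cos).const_mul 2
    refine this.congr_deriv ?_
    simp; ring
  have hqd : ∀ r, HasDerivAt q (q' r) r := by
    intro r
    have := (((hcosd α r).const_add 3).add (hcosd β r)).add (hcosd (α - β) r)
    exact this.congr_deriv (by simp [hq']; ring)
  have hq'le : ∀ r ∈ Set.Ioo (0 : ℝ) (1 / 4), q' r ≤ -(54 / 5 * r) := by
    intro r hr
    have e1 := mul_sin_lower_bound h1 hr.1 hr.2.le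
    have e2 := mul_sin_lower_bound h2 hr.1 hr.2.le
    have e3 := mul_sin_lower_bound h3 hr.1 hr.2.le
    have : (α ^ 2 + β ^ 2 + (α - β) ^ 2) * r = 6 * r := by rw [h6]
    simp only [hq']
    linarith
  have hcos : ∀ c r : ℝ, |c| ≤ 2 → r ∈ Set.Ioo (0 : ℝ) (1 / 4) → 0 < Real.cos (c * r) := by
    intro c r hc hr
    apply Real.cos_pos_of_mem_Ioo
    have : |c * r| ≤ 2 * (1 / 4) := by
      rw [abs_mul, abs_of_pos hr.1]
      exact mul_le_mul hc hr.2.le hr.1.le (by norm_num)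
    have := abs_le.1 this
    constructor <;> linarith [Real.pi_gt_three]
  have hqpos : ∀ r ∈ Set.Ioo (0 : ℝ) (1 / 4), 0 < q r := by
    intro r hr
    have := hcos α r h1 hr
    have := hcos β r h2 hr
    have := hcos _ r h3 hr
    simp only [hq]; linarith
  have hmd : ∀ r ∈ Set.Ioo (0 : ℝ) (1 / 4),
      HasDerivWithinAt (fun r => √(q r)) (q' r / (2 * √(q r))) (Set.Ioo 0 (1 / 4)) r :=
    fun r hr => ((hqd r).sqrt (hqpos r hr).ne').hasDerivWithinAt
  have hqanti : StrictAntiOn q (Set.Ioo 0 (1 / 4)) := by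
    apply strictAntiOn_of_deriv_neg (convex_Ioo _ _)
    · exact fun r _ => (hqd r).continuousAt.continuousWithinAt
    · intro r hr
      rw [interior_Ioo] at hr
      rw [(hqd r).deriv]
      linarith [hq'le r hr, hr.1]
  have hinj : Set.InjOn (fun r => √(q r)) (Set.Ioo 0 (1 / 4)) := by
    intro r hr s hs hrs
    exact hqanti.injOn hr hs ((Real.sqrt_inj (hqpos r hr).le (hqpos s hs).le).1 hrs)
  -- Substitution of `m = √q`, for which `m |m'| = |q'| / 2 ≥ (27 / 5) r`.
  have hcv := lintegral_image_eq_lintegral_abs_deriv_mul measurableSet_Ioo hmd hinj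
    (fun r => ENNReal.ofReal r * Γ r)
  calc _ ≤ ∫⁻ r in Set.Ioo (0 : ℝ) (1 / 4), ENNReal.ofReal (5 / 27) *
        (ENNReal.ofReal |q' r / (2 * √(q r))| * (ENNReal.ofReal √(q r) * Γ √(q r))) := by
        refine setLIntegral_mono' measurableSet_Ioo fun r hr => ?_
        rw [hnorm, ← mul_assoc, ← mul_assoc, ← ENNReal.ofReal_mul (by norm_num),
          ← ENNReal.ofReal_mul (by positivity)]
        gcongr
        have hs : 0 < √(q r) := Real.sqrt_pos.2 (hqpos r hr)
        have h := hq'le r hr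
        have hneg : q' r < 0 := by linarith [hr.1]
        rw [abs_div, abs_of_neg hneg, abs_of_pos (by positivity : 0 < 2 * √(q r))]
        have : 5 / 27 * (-q' r / (2 * √(q r))) * √(q r) = 5 / 27 * (-q' r / 2) := by
          field_simp
        rw [this]; linarith
    _ = ENNReal.ofReal (5 / 27) *
        ∫⁻ r in (fun r => √(q r)) '' Set.Ioo 0 (1 / 4), ENNReal.ofReal r * Γ r := by
        rw [hcv, lintegral_const_mul' _ _ ENNReal.ofReal_ne_top]
    _ ≤ _ := by
        gcongr
        rintro _ ⟨r, hr, rfl⟩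
        exact Real.sqrt_pos.2 (hqpos r hr)

/-- The constant `2π / (√3 · 9/10)`: the factor `2√3` is the Jacobian of
`(x, y) ↦ (√3 x + y, √3 x - y)`, the factor `5/27 = 1 / (6 · 9/10)` comes from
`lintegral_ray_le`, and `2π` is the length of the range of the polar angle. -/
def convConst : ℝ := 2 * √3 * (5 / 27 * (2 * Real.pi))

/-- Integrating a radial function of `1 + exp(ia) + exp(ib)` over small angles `a`, `b`: in polar
coordinates adapted to the quadratic form `a² + b² + (a - b)²` the modulus is a monotone function of
the radius. -/
lemma lintegral_three_phases_le {Γ : ℝ → ℝ≥0∞} (hΓ : Measurable Γ) :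
    ∫⁻ p in Set.Ioo (-(1 / 4) : ℝ) (1 / 4) ×ˢ Set.Ioo (-(1 / 4) : ℝ) (1 / 4),
        Γ ‖1 + Complex.exp ((p.1 : ℝ) * Complex.I) + Complex.exp ((p.2 : ℝ) * Complex.I)‖ ≤
      ENNReal.ofReal convConst * ∫⁻ r in Set.Ioi (0 : ℝ), ENNReal.ofReal r * Γ r := by
  set N : ℝ × ℝ → ℝ≥0∞ := fun p =>
    Γ ‖1 + Complex.exp ((p.1 : ℝ) * Complex.I) + Complex.exp ((p.2 : ℝ) * Complex.I)‖ with hN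
  have hNm : Measurable N := hΓ.comp (by fun_prop)
  set Q : Set (ℝ × ℝ) := Set.Ioo (-(1 / 4) : ℝ) (1 / 4) ×ˢ Set.Ioo (-(1 / 4) : ℝ) (1 / 4) with hQ
  have hQm : MeasurableSet Q := measurableSet_Ioo.prod measurableSet_Ioo
  set I := ∫⁻ r in Set.Ioi (0 : ℝ), ENNReal.ofReal r * Γ r with hI
  have h3 : (√3) ^ 2 = 3 := Real.sq_sqrt (by norm_num)
  rw [← lintegral_indicator hQm, lintegral_prod_linear_change (hNm.indicator hQm),
    ← lintegral_comp_polarCoord_symm]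
  have ht : polarCoord.target = Set.Ioi (0 : ℝ) ×ˢ Set.Ioo (-Real.pi) Real.pi := rfl
  have hpt : ∀ p ∈ polarCoord.target, ENNReal.ofReal p.1 • Q.indicator N
      (√3 * (polarCoord.symm p).1 + (polarCoord.symm p).2,
        √3 * (polarCoord.symm p).1 - (polarCoord.symm p).2) ≤
      (Set.Ioo (0 : ℝ) (1 / 4)).indicator (fun r => ENNReal.ofReal r *
        N ((√3 * Real.cos p.2 + Real.sin p.2) * r, (√3 * Real.cos p.2 - Real.sin p.2) * r)) p.1 := by
    rintro ⟨r, φ⟩ ⟨hr, -⟩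
    simp only [Set.mem_Ioi] at hr
    rw [polarCoord_symm_apply, smul_eq_mul]
    simp only
    have e1 : √3 * (r * Real.cos φ) + r * Real.sin φ = (√3 * Real.cos φ + Real.sin φ) * r := by ring
    have e2 : √3 * (r * Real.cos φ) - r * Real.sin φ = (√3 * Real.cos φ - Real.sin φ) * r := by ring
    rw [e1, e2]
    by_cases hm : ((√3 * Real.cos φ + Real.sin φ) * r, (√3 * Real.cos φ - Real.sin φ) * r) ∈ Q
    · rw [Set.indicator_of_mem hm, Set.indicator_of_mem]
      refine ⟨hr, ?_⟩
      obtain ⟨ha, hb⟩ := hm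
      have ha2 := sq_lt_sq' (by linarith [ha.1]) ha.2
      have hb2 := sq_lt_sq' (by linarith [hb.1]) hb.2
      have hsc := Real.sin_sq_add_cos_sq φ
      have : r ^ 2 < (1 / 4) ^ 2 := by
        nlinarith [sq_nonneg (Real.cos φ * r)]
      exact lt_of_pow_lt_pow_left₀ 2 (by norm_num) this
    · rw [Set.indicator_of_notMem hm, mul_zero]; exact zero_le
  have hmeas : Measurable fun p : ℝ × ℝ =>
      (Set.Ioo (0 : ℝ) (1 / 4)).indicator (fun r => ENNReal.ofReal r *
        N ((√3 * Real.cos p.2 + Real.sin p.2) * r, (√3 * Real.cos p.2 - Real.sin p.2) * r)) p.1 := by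
    have h0 : Measurable fun p : ℝ × ℝ => ENNReal.ofReal p.1 *
        N ((√3 * Real.cos p.2 + Real.sin p.2) * p.1,
          (√3 * Real.cos p.2 - Real.sin p.2) * p.1) :=
      (ENNReal.measurable_ofReal.comp measurable_fst).mul (hNm.comp (by fun_prop))
    exact h0.indicator (measurable_fst measurableSet_Ioo)
  calc _ ≤ ENNReal.ofReal (2 * √3) * ∫⁻ p in polarCoord.target,
      (Set.Ioo (0 : ℝ) (1 / 4)).indicator (fun r => ENNReal.ofReal r *
        N ((√3 * Real.cos p.2 + Real.sin p.2) * r,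
          (√3 * Real.cos p.2 - Real.sin p.2) * r)) p.1 := by
        refine mul_le_mul_right ?_ _
        exact setLIntegral_mono' polarCoord.open_target.measurableSet hpt
    _ ≤ ENNReal.ofReal (2 * √3) * ∫⁻ φ in Set.Ioo (-Real.pi) Real.pi,
          ENNReal.ofReal (5 / 27) * I := by
        rw [ht, Measure.volume_eq_prod, ← Measure.prod_restrict,
          lintegral_prod_symm _ hmeas.aemeasurable]
        gcongr with φ
        simp only
        rw [lintegral_indicator measurableSet_Ioo, Measure.restrict_restrict measurableSet_Ioo,
          Set.inter_eq_left.2 (fun r hr => hr.1)]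
        have hsc := Real.sin_sq_add_cos_sq φ
        have habs : ∀ x y : ℝ, x ^ 2 + y ^ 2 = 4 → |x| ≤ 2 := by
          intro x y h
          apply abs_le_of_sq_le_sq _ (by norm_num)
          nlinarith [sq_nonneg y]
        refine lintegral_ray_le (habs _ (Real.cos φ - √3 * Real.sin φ) ?_)
          (habs _ (Real.cos φ + √3 * Real.sin φ) ?_)
          (habs _ (2 * Real.cos φ) ?_) ?_
        all_goals ring_nf; try rw [h3]
        all_goals linarith
    _ = ENNReal.ofReal convConst * I := by
        rw [setLIntegral_const, Real.volume_Ioo, convConst,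
          ENNReal.ofReal_mul (by positivity : (0 : ℝ) ≤ 2 * √3),
          ENNReal.ofReal_mul (by positivity : (0 : ℝ) ≤ 5 / 27),
          show Real.pi - -Real.pi = 2 * Real.pi by ring]
        ring

lemma mem_Ioo_of_norm_exp_sub_one_lt {a : ℝ}
    (ha : a ∈ Set.Ioo (-Real.pi) Real.pi)
    (h : ‖Complex.exp (a * Complex.I) - 1‖ < 1 / 10) : a ∈ Set.Ioo (-(1 / 4) : ℝ) (1 / 4) := by
  rw [mul_comm, Complex.norm_exp_I_mul_ofReal_sub_one, norm_mul, Real.norm_eq_abs,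
    Real.norm_eq_abs, abs_two] at h
  have h1 : |a / 2| ≤ Real.pi / 2 := by
    rw [abs_le]; constructor <;> linarith [ha.1, ha.2]
  have h2 := Real.mul_abs_le_abs_sin h1
  have h3 : |a| < Real.pi / 20 := by
    rw [abs_div, abs_two] at h2
    have hp := Real.pi_pos
    have : 2 / Real.pi * (|a| / 2) * Real.pi = |a| := by field_simp
    nlinarith
  have h4 := abs_lt.1 h3
  constructor <;> linarith [Real.pi_lt_four]

/-- The threefold convolution of arc length on a short arc has density at most `convConst`. -/
theorem lintegral_arc_triple_le (z : Circle1) {g : Plane → ℝ≥0∞} (hg : Measurable g) :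
    ∫⁻ x in Metric.ball z (1 / 20), ∫⁻ y in Metric.ball z (1 / 20), ∫⁻ w in Metric.ball z (1 / 20),
        g (x + y + w) ∂sigma ∂sigma ∂sigma ≤
      ENNReal.ofReal convConst * ∫⁻ v, g v := by
  set J : Set ℝ := Set.Ioo (-(1 / 4) : ℝ) (1 / 4) with hJ
  set L := planeIso
  set G : ℝ → ℝ × ℝ → ℝ≥0∞ := fun θ p => g (L (Complex.exp (θ * Complex.I) *
    (1 + Complex.exp (p.1 * Complex.I) + Complex.exp (p.2 * Complex.I)))) with hG
  have hGm : Measurable fun p : ℝ × (ℝ × ℝ) => G p.1 p.2 := hg.comp (by fun_prop)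
  -- Bounds the integral over the points of the arc by one over the angles relative to a point.
  have hrel : ∀ θ : ℝ, circlePoint L θ ∈ Metric.ball z (1 / 20) → ∀ {F : Circle1 → ℝ≥0∞},
      Measurable F → ∃ T : ℂ ≃ₗᵢ[ℝ] ℂ, (∀ w, T w = Complex.exp (θ * Complex.I) * w) ∧
      ∫⁻ y in Metric.ball z (1 / 20), F y ∂sigma ≤
        ∫⁻ a in J, F (circlePoint (T.trans L) a) := by
    intro θ hθ F hF
    obtain ⟨T, hT⟩ := exists_iso_mul (Complex.norm_exp_ofReal_mul_I θ)
    refine ⟨T, hT, ?_⟩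
    rw [← lintegral_indicator Metric.isOpen_ball.measurableSet,
      lintegral_sigma_eq (T.trans L) (hF.indicator Metric.isOpen_ball.measurableSet),
      ← lintegral_indicator measurableSet_Ioo, ← lintegral_indicator measurableSet_Ioo]
    refine lintegral_mono fun a => ?_
    by_cases ha : a ∈ Set.Ioo (-Real.pi) Real.pi
    swap
    · rw [Set.indicator_of_notMem ha]; exact zero_le
    rw [Set.indicator_of_mem ha]
    by_cases hb : circlePoint (T.trans L) a ∈ Metric.ball z (1 / 20)
    swap
    · rw [Set.indicator_of_notMem hb]; exact zero_le
    rw [Set.indicator_of_mem hb, Set.indicator_of_mem]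
    apply mem_Ioo_of_norm_exp_sub_one_lt ha
    have h1 : dist (circlePoint (T.trans L) a) (circlePoint L θ) < 1 / 10 := by
      have := dist_triangle_right (circlePoint (T.trans L) a) (circlePoint L θ) z
      rw [Metric.mem_ball] at hθ hb
      linarith
    rw [Subtype.dist_eq, coe_circlePoint, coe_circlePoint, LinearIsometryEquiv.trans_apply,
      LinearIsometryEquiv.dist_map, hT, dist_eq_norm] at h1
    rwa [← mul_sub_one, norm_mul, Complex.norm_exp_ofReal_mul_I, one_mul] at h1
  have hJm : MeasurableSet J := measurableSet_Ioo
  have hgm3 : Measurable fun p : Circle1 × (Circle1 × Circle1) =>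
      g ((p.1 : Plane) + p.2.1 + p.2.2) := hg.comp (by fun_prop)
  have hgm2 : ∀ x : Circle1, Measurable fun p : Circle1 × Circle1 => g ((x : Plane) + p.1 + p.2) :=
    fun x => hg.comp (by fun_prop)
  have hstep : ∀ θ : ℝ, circlePoint L θ ∈ Metric.ball z (1 / 20) →
      ∫⁻ y in Metric.ball z (1 / 20), ∫⁻ w in Metric.ball z (1 / 20),
        g (circlePoint L θ + y + w) ∂sigma ∂sigma ≤ ∫⁻ p in J ×ˢ J, G θ p := by
    intro θ hθ
    obtain ⟨T, hT, h1⟩ := hrel θ hθ (F := fun y => ∫⁻ w in Metric.ball z (1 / 20),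
      g (circlePoint L θ + y + w) ∂sigma) ((hgm2 _).lintegral_prod_right')
    refine h1.trans ?_
    rw [Measure.volume_eq_prod, ← Measure.prod_restrict, lintegral_prod]
    swap
    · exact (hGm.comp measurable_prodMk_left).aemeasurable
    refine lintegral_mono fun a => ?_
    obtain ⟨T', hT', h2⟩ := hrel θ hθ (F := fun w =>
      g (circlePoint L θ + circlePoint (T.trans L) a + w)) (hg.comp (by fun_prop))
    refine h2.trans (lintegral_mono fun b => le_of_eq ?_)
    simp only [hG, coe_circlePoint, LinearIsometryEquiv.trans_apply, hT, hT', ← map_add, mul_add,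
      mul_one]
  -- The first angle runs over the whole circle, so that only the modulus of the sum matters.
  calc _ = ∫⁻ θ in Set.Ioo (-Real.pi) Real.pi, (Metric.ball z (1 / 20)).indicator (fun x =>
        ∫⁻ y in Metric.ball z (1 / 20), ∫⁻ w in Metric.ball z (1 / 20),
          g (x + y + w) ∂sigma ∂sigma) (circlePoint L θ) := by
        rw [← lintegral_indicator Metric.isOpen_ball.measurableSet, lintegral_sigma_eq L]
        refine Measurable.indicator ?_ Metric.isOpen_ball.measurableSet
        refine Measurable.lintegral_prod_right' (f := fun p : Circle1 × Circle1 =>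
          ∫⁻ w in Metric.ball z (1 / 20), g (p.1 + p.2 + w) ∂sigma) ?_
        exact Measurable.lintegral_prod_right' (f := fun p : (Circle1 × Circle1) × Circle1 =>
          g (p.1.1 + p.1.2 + p.2)) (hg.comp (by fun_prop))
    _ ≤ ∫⁻ θ in Set.Ioo (-Real.pi) Real.pi, ∫⁻ p in J ×ˢ J, G θ p := by
        refine lintegral_mono fun θ => ?_
        by_cases hθ : circlePoint L θ ∈ Metric.ball z (1 / 20)
        · rw [Set.indicator_of_mem hθ]; exact hstep θ hθ
        · rw [Set.indicator_of_notMem hθ]; exact zero_le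
    _ = ∫⁻ p in J ×ˢ J, ∫⁻ θ in Set.Ioo (-Real.pi) Real.pi, G θ p :=
        lintegral_lintegral_swap hGm.aemeasurable
    _ = ∫⁻ p in J ×ˢ J, (fun r : ℝ => ∫⁻ x, g (r • (x : Plane)) ∂sigma)
          ‖1 + Complex.exp ((p.1 : ℝ) * Complex.I) + Complex.exp ((p.2 : ℝ) * Complex.I)‖ := by
        refine lintegral_congr fun p => ?_
        exact lintegral_circlePoint_mul L _ hg
    _ ≤ _ := by
        rw [lintegral_plane_polar hg]
        refine lintegral_three_phases_le ?_
        exact Measurable.lintegral_prod_right' (f := fun p : ℝ × Circle1 =>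
          g (p.1 • (p.2 : Plane))) (hg.comp (by fun_prop))

/-! ### Oscillatory integrals and Gaussian weights -/

/-- The oscillatory integral `ξ ↦ ∫ exp(-i ξ·s(x)) H(x) dμ(x)`, that is the Fourier transform of the
image of `H μ` under `s`. -/
def osc {T : Type*} [MeasurableSpace T] (μ : Measure T) (s : T → Plane) (H : T → ℂ) (ξ : Plane) : ℂ :=
  ∫ x, Complex.exp (-Complex.I * ((inner ℝ ξ (s x) : ℝ) : ℂ)) * H x ∂μ

/-- The Fourier transform of the Gaussian weight `exp (-ε |ξ|²)`. -/
def gaussKernel (ε : ℝ) (v : Plane) : ℝ := Real.pi / ε * Real.exp (-(‖v‖ ^ 2 / (4 * ε)))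

/-- The Gaussian weight. -/
def weight (ε : ℝ) (ξ : Plane) : ℝ := Real.exp (-(ε * ‖ξ‖ ^ 2))

lemma gaussKernel_nonneg {ε : ℝ} (hε : 0 < ε) (v : Plane) : 0 ≤ gaussKernel ε v := by
  unfold gaussKernel; positivity

lemma gaussKernel_neg (ε : ℝ) (v : Plane) : gaussKernel ε (-v) = gaussKernel ε v := by
  simp [gaussKernel]

lemma continuous_gaussKernel (ε : ℝ) : Continuous (gaussKernel ε) := by
  unfold gaussKernel; fun_prop

lemma continuous_weight (ε : ℝ) : Continuous (weight ε) := by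
  unfold weight; fun_prop

lemma weight_pos (ε : ℝ) (ξ : Plane) : 0 < weight ε ξ := Real.exp_pos _

lemma integral_exp_mul_weight {ε : ℝ} (hε : 0 < ε) (v : Plane) :
    ∫ ξ, Complex.exp (-Complex.I * ((inner ℝ ξ v : ℝ) : ℂ)) * (weight ε ξ : ℂ) =
      (gaussKernel ε v : ℂ) := by
  have h := GaussianFourier.integral_cexp_neg_mul_sq_norm_add (V := Plane) (b := (ε : ℂ))
    (by simpa using hε) (-Complex.I) v
  have hf : Module.finrank ℝ Plane = 2 := by simp
  rw [hf] at h
  convert h using 1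
  · refine integral_congr_ae (ae_of_all _ fun ξ => ?_)
    simp only [weight]
    push_cast
    rw [← Complex.exp_add, real_inner_comm]
    congr 1; ring
  · unfold gaussKernel
    push_cast
    rw [neg_sq, Complex.I_sq]
    norm_num
    left; congr 1; ring

lemma integrable_weight {ε : ℝ} (hε : 0 < ε) : Integrable (weight ε) := by
  have h := GaussianFourier.integrable_cexp_neg_mul_sq_norm_add (V := Plane) (b := (ε : ℂ))
    (by simpa using hε) 0 0
  refine h.norm.congr (ae_of_all _ fun ξ => ?_)
  simp [weight, Complex.norm_exp, ← Complex.ofReal_pow]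

lemma integral_weight {ε : ℝ} (hε : 0 < ε) : ∫ ξ, weight ε ξ = Real.pi / ε := by
  have h := integral_exp_mul_weight hε 0
  simp only [inner_zero_right, Complex.ofReal_zero, mul_zero, Complex.exp_zero, one_mul] at h
  rw [integral_complex_ofReal] at h
  have := Complex.ofReal_inj.1 h
  simpa [gaussKernel] using this

lemma lintegral_gaussKernel {ε : ℝ} (hε : 0 < ε) :
    ∫⁻ v, ENNReal.ofReal (gaussKernel ε v) = ENNReal.ofReal (4 * Real.pi ^ 2) := by
  have hk : ∀ v, gaussKernel ε v = Real.pi / ε * weight (1 / (4 * ε)) v := by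
    intro v
    unfold gaussKernel weight
    congr 2; ring
  have h4 : 0 < 1 / (4 * ε) := by positivity
  rw [← ofReal_integral_eq_lintegral_ofReal]
  · simp_rw [hk]
    rw [integral_const_mul, integral_weight h4]
    congr 1
    field_simp
  · simp_rw [funext hk]
    exact (integrable_weight h4).const_mul _
  · exact ae_of_all _ (gaussKernel_nonneg hε)

section osc
variable {T T' : Type*} [MeasurableSpace T] [MeasurableSpace T'] {μ : Measure T} {μ' : Measure T'}
  {s : T → Plane} {s' : T' → Plane} {H : T → ℂ} {H' : T' → ℂ}

lemma norm_exp_neg_I_mul (t : ℝ) : ‖Complex.exp (-Complex.I * (t : ℂ))‖ = 1 := by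
  rw [Complex.norm_exp]; simp

lemma integrable_osc_integrand (hs : Measurable s) (hH : Integrable H μ) (ξ : Plane) :
    Integrable (fun x => Complex.exp (-Complex.I * ((inner ℝ ξ (s x) : ℝ) : ℂ)) * H x) μ := by
  refine hH.bdd_mul (c := 1) ?_ (ae_of_all _ fun x => (norm_exp_neg_I_mul _).le)
  exact (Measurable.aestronglyMeasurable (by fun_prop))

lemma osc_mul [SFinite μ] [SFinite μ'] (ξ : Plane) : osc μ s H ξ * osc μ' s' H' ξ =
    osc (μ.prod μ') (fun p => s p.1 + s' p.2) (fun p => H p.1 * H' p.2) ξ := by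
  unfold osc
  rw [← integral_prod_mul]
  refine integral_congr_ae (ae_of_all _ fun p => ?_)
  simp only [inner_add_right, Complex.ofReal_add, mul_add, Complex.exp_add]
  ring

lemma conj_osc (ξ : Plane) : conj (osc μ s H ξ) =
    osc μ (fun x => -s x) (fun x => conj (H x)) ξ := by
  unfold osc
  rw [← integral_conj]
  refine integral_congr_ae (ae_of_all _ fun x => ?_)
  simp only [map_mul, ← Complex.exp_conj, map_neg, Complex.conj_I, Complex.conj_ofReal,
    inner_neg_right, Complex.ofReal_neg]
  ring_nf

lemma norm_osc_le (ξ : Plane) : ‖osc μ s H ξ‖ ≤ ∫ x, ‖H x‖ ∂μ := by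
  refine (norm_integral_le_integral_norm _).trans (le_of_eq ?_)
  simp [norm_exp_neg_I_mul, -neg_mul]

lemma continuous_osc (hs : Measurable s) (hH : Integrable H μ) : Continuous (osc μ s H) := by
  unfold osc
  refine continuous_of_dominated (bound := fun x => ‖H x‖) ?_ ?_ hH.norm ?_
  · exact fun ξ => (integrable_osc_integrand hs hH ξ).aestronglyMeasurable
  · exact fun ξ => ae_of_all _ fun x => by rw [norm_mul, norm_exp_neg_I_mul, one_mul]
  · exact ae_of_all _ fun x => by fun_prop

lemma integral_osc_mul_weight [SFinite μ] (hs : Measurable s) (hH : Integrable H μ) {ε : ℝ}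
    (hε : 0 < ε) :
    ∫ ξ, osc μ s H ξ * (weight ε ξ : ℂ) = ∫ x, (gaussKernel ε (s x) : ℂ) * H x ∂μ := by
  unfold osc
  simp_rw [← integral_mul_const]
  rw [integral_integral_swap]
  · refine integral_congr_ae (ae_of_all _ fun x => ?_)
    simp only
    rw [← integral_exp_mul_weight hε, ← integral_mul_const]
    refine integral_congr_ae (ae_of_all _ fun ξ => ?_)
    ring
  · have h1 : Integrable (fun p : Plane × T => (weight ε p.1 : ℂ) * H p.2) (volume.prod μ) :=
      (integrable_weight hε).ofReal.mul_prod hH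
    refine (h1.bdd_mul (c := 1) (f := fun p : Plane × T =>
      Complex.exp (-Complex.I * ((inner ℝ p.1 (s p.2) : ℝ) : ℂ))) ?_ ?_).congr ?_
    · exact Measurable.aestronglyMeasurable (by fun_prop)
    · exact ae_of_all _ fun p => (norm_exp_neg_I_mul _).le
    · refine ae_of_all _ fun p => ?_
      simp only [Function.uncurry]
      ring

lemma integrable_pow_mul_weight {F : Plane → ℝ} (hF : Continuous F) {C : ℝ}
    (hC : ∀ ξ, ‖F ξ‖ ≤ C) {ε : ℝ} (hε : 0 < ε) : Integrable (fun ξ => F ξ * weight ε ξ) :=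
  (integrable_weight hε).bdd_mul hF.aestronglyMeasurable (ae_of_all _ hC)

/-- Letting the Gaussian weight tend to one. -/
lemma lintegral_le_of_weight {F : Plane → ℝ≥0∞} (hF : Measurable F) {B : ℝ≥0∞} {δ : ℝ → ℝ≥0∞}
    (hδ : Tendsto δ (𝓝[>] 0) (𝓝 0))
    (h : ∀ ε, 0 < ε → ∫⁻ ξ, F ξ * ENNReal.ofReal (weight ε ξ) ≤ B + δ ε) : ∫⁻ ξ, F ξ ≤ B := by
  have hu : Tendsto (fun n : ℕ => 1 / ((n : ℝ) + 1)) atTop (𝓝[>] 0) := by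
    refine tendsto_nhdsWithin_iff.2 ⟨tendsto_one_div_add_atTop_nhds_zero_nat, ?_⟩
    exact Eventually.of_forall fun n => Set.mem_Ioi.2 (by positivity)
  have hpt : ∀ ξ, Tendsto (fun n : ℕ => F ξ * ENNReal.ofReal (weight (1 / ((n : ℝ) + 1)) ξ)) atTop
      (𝓝 (F ξ)) := by
    intro ξ
    have h1 : Tendsto (fun n : ℕ => weight (1 / ((n : ℝ) + 1)) ξ) atTop (𝓝 1) := by
      have : Tendsto (fun ε : ℝ => weight ε ξ) (𝓝[>] 0) (𝓝 (weight 0 ξ)) := by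
        apply Continuous.continuousWithinAt
        unfold weight; fun_prop
      simpa [weight, Function.comp_def] using this.comp hu
    have h2 := ENNReal.tendsto_ofReal h1
    rw [ENNReal.ofReal_one] at h2
    simpa using ENNReal.Tendsto.const_mul (a := F ξ) h2 (Or.inl one_ne_zero)
  have hm : ∀ n : ℕ, Measurable fun ξ => F ξ * ENNReal.ofReal (weight (1 / ((n : ℝ) + 1)) ξ) :=
    fun n => hF.mul ((continuous_weight _).measurable.ennreal_ofReal)
  calc ∫⁻ ξ, F ξ = ∫⁻ ξ, liminf (fun n : ℕ =>
        F ξ * ENNReal.ofReal (weight (1 / ((n : ℝ) + 1)) ξ)) atTop :=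
        lintegral_congr fun ξ => (hpt ξ).liminf_eq.symm
    _ ≤ liminf (fun n : ℕ => ∫⁻ ξ, F ξ * ENNReal.ofReal (weight (1 / ((n : ℝ) + 1)) ξ)) atTop :=
        lintegral_liminf_le hm
    _ ≤ liminf (fun n : ℕ => B + δ (1 / ((n : ℝ) + 1))) atTop :=
        liminf_le_liminf (Eventually.of_forall fun n => h _ (by positivity))
    _ = B := by
        refine Tendsto.liminf_eq ?_
        simpa using tendsto_const_nhds.add (hδ.comp hu)
end osc

/-! ### Positivity of the kernel and Schur's test -/

/-- The Fourier transform of `f μ`, for a measure `μ` on the circle. -/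
def extensionOf (μ : Measure Circle1) (f : Circle1 → ℂ) : Plane → ℂ :=
  osc μ (fun x => (x : Plane)) f

lemma extension_eq (f : Circle1 → ℂ) : extension f = extensionOf sigma f := rfl

/-- The map `(x, y, w) ↦ x + y + w`. -/
def tripleSum (x : Circle1 × Circle1 × Circle1) : Plane := x.1 + (x.2.1 + x.2.2)

/-- The tensor cube of `f`. -/
def tripleProd (f : Circle1 → ℂ) (x : Circle1 × Circle1 × Circle1) : ℂ := f x.1 * (f x.2.1 * f x.2.2)

lemma measurable_tripleSum : Measurable tripleSum := by unfold tripleSum; fun_prop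

section
variable {μ : Measure Circle1} {f : Circle1 → ℂ}

lemma integrable_tripleProd (hf : Integrable f μ) :
    Integrable (tripleProd f) (μ.prod (μ.prod μ)) := hf.mul_prod (hf.mul_prod hf)

lemma continuous_extensionOf (hf : Integrable f μ) : Continuous (extensionOf μ f) :=
  continuous_osc (by fun_prop) hf

lemma norm_extensionOf_le (ξ : Plane) : ‖extensionOf μ f ξ‖ ≤ ∫ x, ‖f x‖ ∂μ := norm_osc_le ξ

lemma integrable_norm_pow_six_mul_weight (hf : Integrable f μ) {ε : ℝ} (hε : 0 < ε) :
    Integrable (fun ξ => ‖extensionOf μ f ξ‖ ^ 6 * weight ε ξ) := by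
  refine integrable_pow_mul_weight (F := fun ξ => ‖extensionOf μ f ξ‖ ^ 6) (C := (∫ x, ‖f x‖ ∂μ) ^ 6)
    ((continuous_extensionOf hf).norm.pow 6) (fun ξ => ?_) hε
  rw [norm_pow, norm_norm]
  gcongr
  exact norm_extensionOf_le ξ

lemma lintegral_weight_eq (hf : Integrable f μ) {ε : ℝ} (hε : 0 < ε) :
    ∫⁻ ξ, ‖extensionOf μ f ξ‖ₑ ^ 6 * ENNReal.ofReal (weight ε ξ) =
      ENNReal.ofReal (∫ ξ, ‖extensionOf μ f ξ‖ ^ 6 * weight ε ξ) := by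
  rw [ofReal_integral_eq_lintegral_ofReal (integrable_norm_pow_six_mul_weight hf hε)]
  · refine lintegral_congr fun ξ => ?_
    rw [ENNReal.ofReal_mul (by positivity), ENNReal.ofReal_pow (norm_nonneg _),
      ofReal_norm]
  · exact ae_of_all _ fun ξ => mul_nonneg (by positivity) (weight_pos _ _).le

variable [IsFiniteMeasure μ]

lemma extensionOf_cube (ξ : Plane) :
    extensionOf μ f ξ ^ 3 = osc (μ.prod (μ.prod μ)) tripleSum (tripleProd f) ξ := by
  rw [pow_succ', pow_two]
  unfold extensionOf
  rw [osc_mul, osc_mul]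
  rfl

lemma norm_pow_six (z : ℂ) : ((‖z‖ ^ 6 : ℝ) : ℂ) = z ^ 3 * conj (z ^ 3) := by
  rw [Complex.mul_conj, Complex.normSq_eq_norm_sq, norm_pow]
  congr 1; ring

/-- The Gaussian-weighted sixth power norm as a form with a positive kernel. -/
lemma integral_norm_pow_six_mul_weight (hf : Integrable f μ) {ε : ℝ} (hε : 0 < ε) :
    ((∫ ξ, ‖extensionOf μ f ξ‖ ^ 6 * weight ε ξ : ℝ) : ℂ) =
      ∫ p, (gaussKernel ε (tripleSum p.1 - tripleSum p.2) : ℂ) *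
        (tripleProd f p.1 * conj (tripleProd f p.2))
          ∂((μ.prod (μ.prod μ)).prod (μ.prod (μ.prod μ))) := by
  have hm := measurable_tripleSum
  rw [← integral_complex_ofReal]
  have h3 := integrable_tripleProd hf
  have h := integral_osc_mul_weight
    (μ := (μ.prod (μ.prod μ)).prod (μ.prod (μ.prod μ)))
    (s := fun p => tripleSum p.1 + -tripleSum p.2)
    (H := fun p => tripleProd f p.1 * conj (tripleProd f p.2)) (by fun_prop)
    (h3.mul_prod (Complex.conjCLE.toContinuousLinearMap.integrable_comp h3)) hε
  simp_rw [sub_eq_add_neg]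
  rw [← h]
  refine integral_congr_ae (ae_of_all _ fun ξ => ?_)
  simp only
  rw [Complex.ofReal_mul, norm_pow_six, extensionOf_cube, conj_osc, osc_mul]

lemma lintegral_weight_le_lintegral_kernel (hf : Integrable f μ) {ε : ℝ} (hε : 0 < ε) :
    ∫⁻ ξ, ‖extensionOf μ f ξ‖ₑ ^ 6 * ENNReal.ofReal (weight ε ξ) ≤
      ∫⁻ p, ENNReal.ofReal (gaussKernel ε (tripleSum p.1 - tripleSum p.2)) *
        (‖tripleProd f p.1‖ₑ * ‖tripleProd f p.2‖ₑ)
          ∂((μ.prod (μ.prod μ)).prod (μ.prod (μ.prod μ))) := by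
  rw [lintegral_weight_eq hf hε]
  have h0 : 0 ≤ ∫ ξ, ‖extensionOf μ f ξ‖ ^ 6 * weight ε ξ :=
    integral_nonneg fun ξ => mul_nonneg (by positivity) (weight_pos _ _).le
  have h1 : ENNReal.ofReal (∫ ξ, ‖extensionOf μ f ξ‖ ^ 6 * weight ε ξ) =
      ‖((∫ ξ, ‖extensionOf μ f ξ‖ ^ 6 * weight ε ξ : ℝ) : ℂ)‖ₑ := by
    rw [← ofReal_norm, Complex.norm_of_nonneg h0]
  rw [h1, integral_norm_pow_six_mul_weight hf hε]
  refine (enorm_integral_le_lintegral_enorm _).trans (le_of_eq (lintegral_congr fun p => ?_))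
  rw [enorm_mul, enorm_mul, RCLike.enorm_conj, ← ofReal_norm,
    Complex.norm_of_nonneg (gaussKernel_nonneg hε _)]

/-- Replacing `f` by its modulus does not decrease the `L⁶` norm, as the kernel is positive. -/
lemma lintegral_extension_pow_le_modulus (hf : Integrable f sigma) :
    ∫⁻ ξ, ‖extension f ξ‖ₑ ^ 6 ≤ ∫⁻ ξ, ‖extension (modulus f) ξ‖ₑ ^ 6 := by
  have hmod : Integrable (modulus f) sigma := hf.norm.ofReal
  simp only [extension_eq]
  refine lintegral_le_of_weight (δ := fun _ => 0)
    ((continuous_extensionOf hf).measurable.enorm.pow_const _) tendsto_const_nhds fun ε hε => ?_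
  rw [add_zero]
  refine le_trans ?_ (lintegral_mono (f := fun ξ =>
    ‖extensionOf sigma (modulus f) ξ‖ₑ ^ 6 * ENNReal.ofReal (weight ε ξ)) fun ξ => ?_)
  swap
  · refine mul_le_of_le_one_right' ?_
    rw [← ENNReal.ofReal_one]
    apply ENNReal.ofReal_le_ofReal
    rw [weight, Real.exp_le_one_iff, neg_nonpos]; positivity
  rw [lintegral_weight_eq hf hε, lintegral_weight_eq hmod hε]
  apply ENNReal.ofReal_le_ofReal
  have h0 : 0 ≤ ∫ ξ, ‖extensionOf sigma f ξ‖ ^ 6 * weight ε ξ :=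
    integral_nonneg fun ξ => mul_nonneg (by positivity) (weight_pos _ _).le
  rw [← Complex.norm_of_nonneg h0, integral_norm_pow_six_mul_weight hf hε]
  refine (norm_integral_le_integral_norm _).trans (le_of_eq ?_)
  rw [← Complex.ofReal_inj, integral_norm_pow_six_mul_weight hmod hε, ← integral_complex_ofReal]
  refine integral_congr_ae (ae_of_all _ fun p => ?_)
  simp only [tripleProd, modulus, norm_mul, Complex.norm_of_nonneg (gaussKernel_nonneg hε _),
    RCLike.norm_conj, map_mul, Complex.conj_ofReal, Complex.ofReal_mul]

lemma two_mul_enorm_mul_le (a b : ℂ) : 2 * (‖a‖ₑ * ‖b‖ₑ) ≤ ‖a‖ₑ ^ 2 + ‖b‖ₑ ^ 2 := by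
  have := two_mul_le_add_sq ‖a‖₊ ‖b‖₊
  rw [mul_assoc] at this
  simp only [enorm_eq_nnnorm]
  exact_mod_cast this

/-- Schur's test: a uniform bound for the threefold convolution of `μ` bounds the extension
operator from `L²(μ)` to `L⁶`. -/
theorem lintegral_extensionOf_pow_le (hf : Integrable f μ) {M : ℝ≥0∞}
    (hM : ∀ ε, 0 < ε → ∀ v : Plane,
      ∫⁻ y, ENNReal.ofReal (gaussKernel ε (v - tripleSum y)) ∂(μ.prod (μ.prod μ)) ≤ M) :
    ∫⁻ ξ, ‖extensionOf μ f ξ‖ₑ ^ 6 ≤ M * (∫⁻ x, ‖f x‖ₑ ^ 2 ∂μ) ^ 3 := by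
  refine lintegral_le_of_weight (δ := fun _ => 0)
    ((continuous_extensionOf hf).measurable.enorm.pow_const _) tendsto_const_nhds fun ε hε => ?_
  rw [add_zero]
  refine (lintegral_weight_le_lintegral_kernel hf hε).trans ?_
  set τ := μ.prod (μ.prod μ) with hτ
  have hm := measurable_tripleSum
  have hK : Measurable fun p : (Circle1 × Circle1 × Circle1) × (Circle1 × Circle1 × Circle1) =>
      ENNReal.ofReal (gaussKernel ε (tripleSum p.1 - tripleSum p.2)) := by
    have := (continuous_gaussKernel ε).measurable
    fun_prop
  have hH : AEMeasurable (fun x => ‖tripleProd f x‖ₑ ^ 2) τ :=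
    ((integrable_tripleProd hf).aestronglyMeasurable.enorm).pow_const 2
  have hcube : ∫⁻ x, ‖tripleProd f x‖ₑ ^ 2 ∂τ = (∫⁻ x, ‖f x‖ₑ ^ 2 ∂μ) ^ 3 := by
    have h2 : AEMeasurable (fun x => ‖f x‖ₑ ^ 2) μ := hf.aestronglyMeasurable.enorm.pow_const 2
    simp_rw [tripleProd, enorm_mul, mul_pow]
    rw [hτ, lintegral_prod_mul (g := fun y : Circle1 × Circle1 => ‖f y.1‖ₑ ^ 2 * ‖f y.2‖ₑ ^ 2) h2,
      lintegral_prod_mul h2 h2]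
    · ring
    · exact (h2.comp_quasiMeasurePreserving Measure.quasiMeasurePreserving_fst).mul
        (h2.comp_quasiMeasurePreserving Measure.quasiMeasurePreserving_snd)
  have h1 : ∫⁻ p, ENNReal.ofReal (gaussKernel ε (tripleSum p.1 - tripleSum p.2)) *
      ‖tripleProd f p.1‖ₑ ^ 2 ∂(τ.prod τ) ≤ M * ∫⁻ x, ‖tripleProd f x‖ₑ ^ 2 ∂τ := by
    rw [lintegral_prod]
    swap
    · exact hK.aemeasurable.mul
        (hH.comp_quasiMeasurePreserving Measure.quasiMeasurePreserving_fst)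
    rw [← lintegral_const_mul'' _ hH]
    refine lintegral_mono fun x => ?_
    simp only
    rw [lintegral_mul_const' _ _ (by finiteness)]
    gcongr
    exact hM ε hε _
  have h2 : ∫⁻ p, ENNReal.ofReal (gaussKernel ε (tripleSum p.1 - tripleSum p.2)) *
      ‖tripleProd f p.2‖ₑ ^ 2 ∂(τ.prod τ) ≤ M * ∫⁻ x, ‖tripleProd f x‖ₑ ^ 2 ∂τ := by
    refine le_trans (le_of_eq ?_) h1
    rw [← lintegral_prod_swap]
    refine lintegral_congr fun p => ?_
    simp only [Prod.fst_swap, Prod.snd_swap]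
    rw [← gaussKernel_neg, neg_sub]
  have h3 : 2 * ∫⁻ p, ENNReal.ofReal (gaussKernel ε (tripleSum p.1 - tripleSum p.2)) *
      (‖tripleProd f p.1‖ₑ * ‖tripleProd f p.2‖ₑ) ∂(τ.prod τ) ≤
      2 * (M * ∫⁻ x, ‖tripleProd f x‖ₑ ^ 2 ∂τ) := by
    rw [← lintegral_const_mul' _ _ ENNReal.ofNat_ne_top, two_mul (M * _)]
    refine le_trans ?_ (add_le_add h1 h2)
    rw [← lintegral_add_left']
    · refine lintegral_mono fun p => ?_
      simp only
      rw [← mul_add, mul_left_comm]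
      gcongr
      exact two_mul_enorm_mul_le _ _
    · exact hK.aemeasurable.mul
        (hH.comp_quasiMeasurePreserving Measure.quasiMeasurePreserving_fst)
  rw [← hcube]
  exact (ENNReal.mul_le_mul_iff_right two_ne_zero ENNReal.ofNat_ne_top).1 h3
end

/-- The constant in the extension inequality for the sixth power of the norm on short arcs; `4π²` is
the integral of `gaussKernel ε`. -/
def arcConst : ℝ := convConst * (4 * Real.pi ^ 2)

lemma extensionOf_restrict {S : Set Circle1} {f : Circle1 → ℂ}
    (hsupp : ∀ x, x ∉ S → f x = 0) : extensionOf (sigma.restrict S) f = extension f := by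
  ext ξ
  exact setIntegral_eq_integral_of_forall_compl_eq_zero fun x hx => by rw [hsupp x hx, mul_zero]

/-- The extension inequality for functions on a short arc. -/
theorem lintegral_extension_pow_le_of_arc (z : Circle1) {f : Circle1 → ℂ} (hf : Integrable f sigma)
    (hsupp : ∀ x, x ∉ Metric.ball z (1 / 20) → f x = 0) :
    ∫⁻ ξ, ‖extension f ξ‖ₑ ^ 6 ≤ ENNReal.ofReal arcConst * (∫⁻ x, ‖f x‖ₑ ^ 2 ∂sigma) ^ 3 := by
  rw [← extensionOf_restrict hsupp]
  have h := lintegral_extensionOf_pow_le (μ := sigma.restrict (Metric.ball z (1 / 20)))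
    (f := f) hf.restrict (M := ENNReal.ofReal arcConst) ?_
  · refine h.trans ?_
    gcongr
    exact Measure.restrict_le_self
  intro ε hε v
  have hm := measurable_tripleSum
  have hg : Measurable fun w : Plane => ENNReal.ofReal (gaussKernel ε (v - w)) := by
    have := (continuous_gaussKernel ε).measurable
    fun_prop
  have h0 := lintegral_arc_triple_le z hg
  rw [lintegral_sub_left_eq_self (fun w => ENNReal.ofReal (gaussKernel ε w)) v,
    lintegral_gaussKernel hε, ← ENNReal.ofReal_mul (by unfold convConst; positivity)] at h0
  refine le_trans (le_of_eq ?_) h0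
  have hgm : Measurable fun y => ENNReal.ofReal (gaussKernel ε (v - tripleSum y)) := hg.comp hm
  rw [lintegral_prod _ hgm.aemeasurable]
  refine lintegral_congr fun x => ?_
  rw [lintegral_prod]
  · simp [tripleSum, add_assoc]
  · exact (hgm.comp measurable_prodMk_left).aemeasurable

/-! ### Spectral localization and antipodal arcs -/

/-- `F` is the Fourier transform of a complex measure carried by the strip
`{v | a ≤ ⟪v, z⟫ ≤ b}`, written as an oscillatory integral. -/
def HasSpectrum (F : Plane → ℂ) (z : Plane) (a b : ℝ) : Prop :=
  ∃ (T : Type) (_ : MeasurableSpace T) (μ : Measure T) (_ : SFinite μ) (s : T → Plane) (H : T → ℂ),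
    Measurable s ∧ Integrable H μ ∧ (∀ᵐ x ∂μ, a ≤ inner ℝ (s x) z ∧ inner ℝ (s x) z ≤ b) ∧
      F = osc μ s H

namespace HasSpectrum
variable {F G : Plane → ℂ} {z : Plane} {a b c d : ℝ}

lemma one : HasSpectrum (fun _ => 1) z 0 0 := by
  refine ⟨Unit, inferInstance, Measure.dirac (), inferInstance, fun _ => 0, fun _ => 1,
    measurable_const, integrable_const _, ae_of_all _ (by simp), ?_⟩
  ext ξ
  simp [osc]

lemma mul (hF : HasSpectrum F z a b) (hG : HasSpectrum G z c d) :
    HasSpectrum (fun ξ => F ξ * G ξ) z (a + c) (b + d) := by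
  obtain ⟨T, _, μ, _, s, H, hs, hH, hsp, rfl⟩ := hF
  obtain ⟨T', _, μ', _, s', H', hs', hH', hsp', rfl⟩ := hG
  refine ⟨T × T', inferInstance, μ.prod μ', inferInstance, fun p => s p.1 + s' p.2,
    fun p => H p.1 * H' p.2, by fun_prop, hH.mul_prod hH', ?_, funext fun ξ => osc_mul ξ⟩
  filter_upwards [Measure.quasiMeasurePreserving_fst.ae hsp,
    Measure.quasiMeasurePreserving_snd.ae hsp'] with p h1 h2
  rw [inner_add_left]
  exact ⟨add_le_add h1.1 h2.1, add_le_add h1.2 h2.2⟩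

lemma pow (hF : HasSpectrum F z a b) (n : ℕ) :
    HasSpectrum (fun ξ => F ξ ^ n) z (n * a) (n * b) := by
  induction n with
  | zero => simpa using one
  | succ n ih =>
    simpa [pow_succ, add_mul] using ih.mul hF

lemma conjugate (hF : HasSpectrum F z a b) :
    HasSpectrum (fun ξ => conj (F ξ)) z (-b) (-a) := by
  obtain ⟨T, _, μ, _, s, H, hs, hH, hsp, rfl⟩ := hF
  refine ⟨T, inferInstance, μ, inferInstance, fun x => -s x, fun x => conj (H x), hs.neg,
    Complex.conjCLE.toContinuousLinearMap.integrable_comp hH, ?_, funext fun ξ => conj_osc ξ⟩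
  filter_upwards [hsp] with x hx
  rw [inner_neg_left]
  exact ⟨neg_le_neg hx.2, neg_le_neg hx.1⟩

/-- A Fourier transform whose spectrum avoids the unit disc has negligible Gaussian means. -/
lemma norm_integral_mul_weight_le (hF : HasSpectrum F z a b) (hz : ‖z‖ = 1)
    (hab : 1 ≤ a ∨ b ≤ -1) : ∃ C : ℝ, 0 ≤ C ∧ ∀ ε, 0 < ε →
      ‖∫ ξ, F ξ * (weight ε ξ : ℂ)‖ ≤ C * (Real.pi / ε * Real.exp (-(1 / (4 * ε)))) := by
  obtain ⟨T, _, μ, _, s, H, hs, hH, hsp, rfl⟩ := hF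
  refine ⟨∫ x, ‖H x‖ ∂μ, integral_nonneg fun _ => norm_nonneg _, fun ε hε => ?_⟩
  rw [integral_osc_mul_weight hs hH hε, mul_comm, ← integral_const_mul]
  refine norm_integral_le_of_norm_le (hH.norm.const_mul _) ?_
  filter_upwards [hsp] with x hx
  rw [norm_mul, Complex.norm_of_nonneg (gaussKernel_nonneg hε _)]
  gcongr
  unfold gaussKernel
  have h1 : 1 ≤ ‖s x‖ := by
    have h2 := abs_real_inner_le_norm (s x) z
    rw [hz, mul_one] at h2
    refine le_trans ?_ h2
    rcases hab with h | h
    · exact (h.trans hx.1).trans (le_abs_self _)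
    · linarith [neg_le_abs (inner ℝ (s x) z), hx.2]
  gcongr
  exact one_le_pow₀ h1

end HasSpectrum

lemma tendsto_gaussian_remainder :
    Tendsto (fun ε : ℝ => Real.pi / ε * Real.exp (-(1 / (4 * ε)))) (𝓝[>] 0) (𝓝 0) := by
  have h := Real.tendsto_pow_mul_exp_neg_atTop_nhds_zero 1
  have h1 : Tendsto (fun ε : ℝ => 4⁻¹ * ε⁻¹) (𝓝[>] 0) atTop :=
    tendsto_inv_nhdsGT_zero.const_mul_atTop (by norm_num)
  have h2 := (h.comp h1).const_mul (4 * Real.pi)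
  rw [mul_zero] at h2
  refine h2.congr fun ε => ?_
  simp only [Function.comp, pow_one]
  rw [one_div, mul_inv]
  ring

lemma inner_ge_of_mem_ball {z x : Circle1} (hx : x ∈ Metric.ball z (1 / 20)) :
    99 / 100 ≤ inner ℝ (x : Plane) (z : Plane) ∧ inner ℝ (x : Plane) (z : Plane) ≤ 1 := by
  have hx1 : ‖(x : Plane)‖ = 1 := by simp
  have hz1 : ‖(z : Plane)‖ = 1 := by simp
  have h := norm_sub_sq_real (x : Plane) z
  rw [Metric.mem_ball, Subtype.dist_eq, dist_eq_norm] at hx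
  have h2 : ‖(x : Plane) - z‖ ^ 2 ≤ (1 / 20) ^ 2 := by gcongr
  rw [hx1, hz1] at h
  constructor
  · linarith
  · have := real_inner_le_norm (x : Plane) (z : Plane)
    rwa [hx1, hz1, mul_one] at this

lemma hasSpectrum_extension (z : Circle1) {f : Circle1 → ℂ} (hf : Integrable f sigma)
    (hsupp : ∀ x, x ∉ Metric.ball z (1 / 20) → f x = 0) :
    HasSpectrum (extension f) z (99 / 100) 1 := by
  refine ⟨Circle1, inferInstance, sigma.restrict (Metric.ball z (1 / 20)), inferInstance,
    fun x => (x : Plane), f, by fun_prop, hf.restrict, ?_, (extensionOf_restrict hsupp).symm⟩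
  filter_upwards [ae_restrict_mem Metric.isOpen_ball.measurableSet] with x hx
  exact inner_ge_of_mem_ball hx

/-- For `P` the extension of a function on a short arc, only the diagonal term of the binomial
expansion of `(P + conj P)⁶` contributes to the `L⁶` norm: the frequencies of the others stay away
from the origin. -/
theorem lintegral_add_conj_pow_le (z : Circle1) {f : Circle1 → ℂ} (hf : Integrable f sigma)
    (hsupp : ∀ x, x ∉ Metric.ball z (1 / 20) → f x = 0) :
    ∫⁻ ξ, ‖extension f ξ + conj (extension f ξ)‖ₑ ^ 6 ≤ 20 * ∫⁻ ξ, ‖extension f ξ‖ₑ ^ 6 := by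
  set P := extension f with hP
  have hPc : Continuous P := continuous_extensionOf hf
  set D : ℝ := ∫ x, ‖f x‖ ∂sigma
  have hPb : ∀ ξ, ‖P ξ‖ ≤ D := norm_extensionOf_le
  have hspec := hasSpectrum_extension z hf hsupp
  have hz : ‖(z : Plane)‖ = 1 := by simp
  -- `P ^ k * conj P ^ (6 - k)` has spectrum in `⟪v, z⟫ ≥ 1` for `k ≥ 4`, in `⟪v, z⟫ ≤ -1` for `k ≤ 2`.
  have hterm : ∀ k ∈ (Finset.range 7).erase 3, ∃ C : ℝ, 0 ≤ C ∧ ∀ ε, 0 < ε →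
      ‖∫ ξ, (P ξ ^ k * conj (P ξ) ^ (6 - k)) * (weight ε ξ : ℂ)‖ ≤
        C * (Real.pi / ε * Real.exp (-(1 / (4 * ε)))) := by
    intro k hk
    refine ((hspec.pow k).mul (hspec.conjugate.pow (6 - k))).norm_integral_mul_weight_le hz ?_
    simp only [Finset.mem_erase, Finset.mem_range] at hk
    obtain ⟨hk3, hk7⟩ := hk
    interval_cases k <;> first | exact absurd rfl hk3 | norm_num
  choose! C hC0 hC using hterm
  refine lintegral_le_of_weight (δ := fun ε => ENNReal.ofReal
    (∑ k ∈ (Finset.range 7).erase 3, Nat.choose 6 k * C k *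
      (Real.pi / ε * Real.exp (-(1 / (4 * ε)))))) (by fun_prop) ?_ fun ε hε => ?_
  · simp_rw [← Finset.sum_mul]
    have := tendsto_gaussian_remainder.const_mul
      (∑ k ∈ (Finset.range 7).erase 3, (Nat.choose 6 k : ℝ) * C k)
    rw [mul_zero] at this
    simpa using ENNReal.tendsto_ofReal this
  have hint : ∀ k ∈ Finset.range 7,
      Integrable fun ξ => (P ξ ^ k * conj (P ξ) ^ (6 - k)) * (weight ε ξ : ℂ) := by
    intro k _
    refine (integrable_weight hε).ofReal.bdd_mul (c := D ^ k * D ^ (6 - k)) ?_ ?_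
    · exact Continuous.aestronglyMeasurable (by fun_prop)
    · refine ae_of_all _ fun ξ => ?_
      rw [norm_mul, norm_pow, norm_pow, RCLike.norm_conj]
      have := hPb ξ
      gcongr
  have h1 : ∫⁻ ξ, ‖P ξ + conj (P ξ)‖ₑ ^ 6 * ENNReal.ofReal (weight ε ξ) =
      ENNReal.ofReal (∫ ξ, ‖P ξ + conj (P ξ)‖ ^ 6 * weight ε ξ) := by
    rw [ofReal_integral_eq_lintegral_ofReal]
    · refine lintegral_congr fun ξ => ?_
      rw [ENNReal.ofReal_mul (by positivity), ENNReal.ofReal_pow (norm_nonneg _), ofReal_norm]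
    · refine integrable_pow_mul_weight (F := fun ξ => ‖P ξ + conj (P ξ)‖ ^ 6) (C := (D + D) ^ 6)
        (by fun_prop) (fun ξ => ?_) hε
      rw [norm_pow, norm_norm]
      gcongr
      refine (norm_add_le _ _).trans ?_
      rw [RCLike.norm_conj]
      exact add_le_add (hPb ξ) (hPb ξ)
    · exact ae_of_all _ fun ξ => mul_nonneg (by positivity) (weight_pos _ _).le
  have h2 : ((∫ ξ, ‖P ξ + conj (P ξ)‖ ^ 6 * weight ε ξ : ℝ) : ℂ) =
      ∑ k ∈ Finset.range 7, ∫ ξ, (P ξ ^ k * conj (P ξ) ^ (6 - k)) * (weight ε ξ : ℂ) *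
        (Nat.choose 6 k : ℂ) := by
    rw [← integral_complex_ofReal, ← integral_finsetSum _ fun k hk => (hint k hk).mul_const _]
    refine integral_congr_ae (ae_of_all _ fun ξ => ?_)
    simp only
    rw [Complex.ofReal_mul, norm_pow_six, map_pow, map_add, Complex.conj_conj,
      add_comm (conj (P ξ)) (P ξ), ← pow_add, add_pow, Finset.sum_mul]
    exact Finset.sum_congr rfl fun k _ => by ring
  have hdiag : ∫ ξ, (P ξ ^ 3 * conj (P ξ) ^ (6 - 3)) * (weight ε ξ : ℂ) =
      ((∫ ξ, ‖P ξ‖ ^ 6 * weight ε ξ : ℝ) : ℂ) := by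
    rw [← integral_complex_ofReal]
    refine integral_congr_ae (ae_of_all _ fun ξ => ?_)
    simp only
    rw [Complex.ofReal_mul, norm_pow_six, map_pow]
  have h0 : 0 ≤ ∫ ξ, ‖P ξ‖ ^ 6 * weight ε ξ :=
    integral_nonneg fun ξ => mul_nonneg (by positivity) (weight_pos _ _).le
  have h0' : 0 ≤ ∫ ξ, ‖P ξ + conj (P ξ)‖ ^ 6 * weight ε ξ :=
    integral_nonneg fun ξ => mul_nonneg (by positivity) (weight_pos _ _).le
  have h3 : ∫ ξ, ‖P ξ + conj (P ξ)‖ ^ 6 * weight ε ξ ≤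
      20 * (∫ ξ, ‖P ξ‖ ^ 6 * weight ε ξ) + ∑ k ∈ (Finset.range 7).erase 3, Nat.choose 6 k * C k *
      (Real.pi / ε * Real.exp (-(1 / (4 * ε)))) := by
    rw [← Complex.norm_of_nonneg h0', h2, ← Finset.add_sum_erase _ _ (show 3 ∈ Finset.range 7 by simp)]
    refine (norm_add_le _ _).trans (add_le_add (le_of_eq ?_) ?_)
    · rw [integral_mul_const, hdiag, norm_mul, Complex.norm_of_nonneg h0]
      norm_num [Nat.choose]
      ring
    · refine (norm_sum_le _ _).trans (Finset.sum_le_sum fun k hk => ?_)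
      rw [integral_mul_const, norm_mul, Complex.norm_natCast, mul_comm, mul_assoc]
      gcongr
      exact hC k hk ε hε
  rw [h1]
  refine (ENNReal.ofReal_le_ofReal h3).trans ?_
  rw [ENNReal.ofReal_add (by positivity) (Finset.sum_nonneg fun k hk => by
    have := hC0 k hk; positivity), ENNReal.ofReal_mul (by norm_num),
    show (∫ ξ, ‖P ξ‖ ^ 6 * weight ε ξ) = ∫ ξ, ‖extensionOf sigma f ξ‖ ^ 6 * weight ε ξ from rfl,
    ← lintegral_weight_eq hf hε]
  gcongr
  · simp
  · refine mul_le_of_le_one_right' ?_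
    rw [← ENNReal.ofReal_one]
    apply ENNReal.ofReal_le_ofReal
    rw [weight, Real.exp_le_one_iff, neg_nonpos]; positivity

/-! ### The Tomas–Stein inequality and a lower bound for its constant -/

section norms
variable {T : Type*} [MeasurableSpace T] {μ : Measure T}

lemma eLpNorm_six_pow (F : T → ℂ) : eLpNorm F 6 μ ^ 6 = ∫⁻ x, ‖F x‖ₑ ^ 6 ∂μ := by
  have := eLpNorm_nnreal_pow_eq_lintegral (μ := μ) (f := F) (p := 6) (by norm_num)
  simpa using this

lemma eLpNorm_two_pow (F : T → ℂ) : eLpNorm F 2 μ ^ 2 = ∫⁻ x, ‖F x‖ₑ ^ 2 ∂μ := by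
  have := eLpNorm_nnreal_pow_eq_lintegral (μ := μ) (f := F) (p := 2) (by norm_num)
  simpa using this
end norms

lemma integrable_of_memLp_two {f : Circle1 → ℂ} (hf : MemLp f 2 sigma) : Integrable f sigma :=
  hf.integrable (by norm_num)

lemma continuous_extension {f : Circle1 → ℂ} (hf : Integrable f sigma) : Continuous (extension f) :=
  continuous_extensionOf hf

lemma extension_add {f g : Circle1 → ℂ} (hf : Integrable f sigma) (hg : Integrable g sigma) :
    extension (f + g) = extension f + extension g := by
  ext ξ
  have h1 := integrable_osc_integrand (s := fun x : Circle1 => (x : Plane)) (by fun_prop) hf ξ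
  have h2 := integrable_osc_integrand (s := fun x : Circle1 => (x : Plane)) (by fun_prop) hg ξ
  simp only [extension, Pi.add_apply, mul_add]
  exact integral_add h1 h2

lemma extension_smul (c : ℂ) (f : Circle1 → ℂ) : extension (c • f) = c • extension f := by
  ext ξ
  simp only [extension, Pi.smul_apply, smul_eq_mul]
  rw [← integral_const_mul]
  exact integral_congr_ae (ae_of_all _ fun x => by ring)

lemma extension_congr {f g : Circle1 → ℂ} (h : f =ᵐ[sigma] g) : extension f = extension g := by
  ext ξ
  refine integral_congr_ae ?_
  filter_upwards [h] with x hx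
  rw [hx]

/-- The extension inequality, with the optimal constant. -/
theorem eLpNorm_extension_le {f : Circle1 → ℂ} (hf : MemLp f 2 sigma) :
    eLpNorm (extension f) 6 volume ≤ optimalConstant * eLpNorm f 2 sigma := by
  -- The optimal constant is a supremum over unit vectors only, so zero functions are separate.
  by_cases h0 : eLpNorm f 2 sigma = 0
  · have h1 : f =ᵐ[sigma] 0 := (eLpNorm_eq_zero_iff hf.1 two_ne_zero).1 h0
    have h2 : extension f = 0 := by
      rw [extension_congr h1]; ext ξ; simp [extension]
    rw [h2, eLpNorm_zero]; exact zero_le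
  set t := (eLpNorm f 2 sigma).toReal with ht
  have ht0 : 0 < t := ENNReal.toReal_pos h0 hf.2.ne
  have hte : eLpNorm f 2 sigma = ENNReal.ofReal t := (ENNReal.ofReal_toReal hf.2.ne).symm
  have hc : ‖((t : ℂ)⁻¹)‖ₑ = (ENNReal.ofReal t)⁻¹ := by
    rw [← ofReal_norm, norm_inv, Complex.norm_of_nonneg ht0.le, ENNReal.ofReal_inv_of_pos ht0]
  have h1 : eLpNorm ((t : ℂ)⁻¹ • f) 2 sigma = 1 := by
    rw [eLpNorm_const_smul, hc, hte, ENNReal.inv_mul_cancel] <;> simp [ht0]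
  have h2 : eLpNorm (extension ((t : ℂ)⁻¹ • f)) 6 volume ≤ optimalConstant :=
    le_iSup₂_of_le _ (hf.const_smul _) (le_iSup_of_le h1 le_rfl)
  rw [extension_smul, eLpNorm_const_smul, hc] at h2
  rw [hte]
  rwa [mul_comm, ← div_eq_mul_inv, ENNReal.div_le_iff (by simp [ht0]) (by simp)] at h2

lemma pow_six_le_iff {a b : ℝ≥0∞} : a ^ 6 ≤ b ^ 6 ↔ a ≤ b :=
  (ENNReal.pow_right_strictMono (by norm_num)).le_iff_le

/-- The constant of the extension inequality on short arcs, the sixth root of `arcConst`. -/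
def arcNorm : ℝ≥0∞ := ENNReal.ofReal arcConst ^ (1 / 6 : ℝ)

lemma arcNorm_pow : arcNorm ^ 6 = ENNReal.ofReal arcConst := by
  unfold arcNorm
  rw [← ENNReal.rpow_natCast, ← ENNReal.rpow_mul]
  norm_num

lemma eLpNorm_extension_le_of_arc (z : Circle1) {f : Circle1 → ℂ} (hf : MemLp f 2 sigma)
    (hsupp : ∀ x, x ∉ Metric.ball z (1 / 20) → f x = 0) :
    eLpNorm (extension f) 6 volume ≤ arcNorm * eLpNorm f 2 sigma := by
  rw [← pow_six_le_iff, mul_pow, arcNorm_pow, eLpNorm_six_pow,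
    show eLpNorm f 2 sigma ^ 6 = (eLpNorm f 2 sigma ^ 2) ^ 3 by ring, eLpNorm_two_pow]
  exact lintegral_extension_pow_le_of_arc z (integrable_of_memLp_two hf) hsupp

/-- Functions carried by finitely many short arcs, split into pieces on single arcs. -/
lemma eLpNorm_extension_le_of_arcs (s : Finset Circle1) : ∀ f : Circle1 → ℂ, MemLp f 2 sigma →
    (∀ x, x ∉ ⋃ z ∈ s, Metric.ball z (1 / 20) → f x = 0) →
    eLpNorm (extension f) 6 volume ≤ s.card * (arcNorm * eLpNorm f 2 sigma) := by
  classical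
  induction s using Finset.induction_on with
  | empty =>
    intro f hf h0
    have : f = 0 := funext fun x => h0 x (by simp)
    subst this
    have h2 : extension (0 : Circle1 → ℂ) = 0 := by ext ξ; simp [extension]
    simp [h2]
  | insert z s hz ih =>
    intro f hf h0
    set B := Metric.ball z (1 / 20) with hB
    have hBm : MeasurableSet B := Metric.isOpen_ball.measurableSet
    have h1 := eLpNorm_extension_le_of_arc z (hf.indicator hBm)
      (fun x hx => Set.indicator_of_notMem hx _)
    have h2 := ih (Bᶜ.indicator f) (hf.indicator hBm.compl) (fun x hx => by
      by_cases hxB : x ∈ B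
      · exact Set.indicator_of_notMem (by simpa using hxB) _
      · rw [Set.indicator_of_mem (by simpa using hxB)]
        apply h0
        rw [Finset.set_biUnion_insert]
        exact fun h => h.elim hxB hx)
    have hsplit : extension f = extension (B.indicator f) + extension (Bᶜ.indicator f) := by
      rw [← extension_add (integrable_of_memLp_two (hf.indicator hBm))
        (integrable_of_memLp_two (hf.indicator hBm.compl)), Set.indicator_self_add_compl]
    rw [hsplit, Finset.card_insert_of_notMem hz, Nat.cast_add, Nat.cast_one, add_mul, one_mul,
      add_comm _ (arcNorm * _)]
    refine (eLpNorm_add_le ?_ ?_ (by norm_num)).trans (add_le_add (h1.trans ?_) (h2.trans ?_))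
    · exact (continuous_extension (integrable_of_memLp_two (hf.indicator hBm))).aestronglyMeasurable
    · exact (continuous_extension (integrable_of_memLp_two (hf.indicator hBm.compl))).aestronglyMeasurable
    · gcongr; exact eLpNorm_indicator_le _
    · gcongr; exact eLpNorm_indicator_le _

/-- The Tomas–Stein inequality. -/
theorem optimalConstant_ne_top : optimalConstant ≠ ∞ := by
  obtain ⟨t, -, ht⟩ := (isCompact_univ (X := Circle1)).elim_nhds_subcover
    (fun z => Metric.ball z (1 / 20)) (fun z _ => Metric.ball_mem_nhds z (by norm_num))
  have h : optimalConstant ≤ t.card * (arcNorm * 1) := by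
    refine iSup₂_le fun f hf => iSup_le fun h1 => ?_
    rw [← h1]
    exact eLpNorm_extension_le_of_arcs t f hf fun x hx => absurd (ht (Set.mem_univ x)) hx
  refine ne_top_of_le_ne_top ?_ h
  have : arcNorm ≠ ∞ := by
    intro h
    have h2 := arcNorm_pow
    rw [h, ENNReal.top_pow (by norm_num)] at h2
    exact ENNReal.ofReal_ne_top h2.symm
  finiteness

lemma exists_iso_norm_smul (ξ : Plane) : ∃ L : ℂ ≃ₗᵢ[ℝ] Plane, ξ = ‖ξ‖ • L 1 := by
  by_cases h : ξ = 0
  · exact ⟨planeIso, by simp [h]⟩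
  · have h1 : ‖ξ‖ ≠ 0 := norm_ne_zero_iff.2 h
    obtain ⟨L, hL⟩ := exists_iso_apply_one ⟨‖ξ‖⁻¹ • ξ, by simp [norm_smul, h1]⟩
    exact ⟨L, by rw [hL, smul_inv_smul₀ h1]⟩

lemma extension_one_eq (ξ : Plane) : extension 1 ξ =
    ∫ θ in Set.Ioo (-Real.pi) Real.pi,
      Complex.exp (-Complex.I * ((‖ξ‖ * Real.cos θ : ℝ) : ℂ)) := by
  obtain ⟨L, hL⟩ := exists_iso_norm_smul ξ
  have h : ∀ θ, inner ℝ ξ (circlePoint L θ : Plane) = ‖ξ‖ * Real.cos θ := by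
    intro θ
    conv_lhs => rw [hL]
    rw [real_inner_smul_left, coe_circlePoint, LinearIsometryEquiv.inner_map_map,
      Complex.inner, map_one, mul_one, Complex.exp_ofReal_mul_I_re]
  simp only [extension, Pi.one_apply, mul_one]
  conv_lhs => rw [← map_circlePoint L]
  rw [integral_map (measurable_circlePoint L).aemeasurable
    (Measurable.aestronglyMeasurable (by fun_prop))]
  simp_rw [h]

/-- The elementary bound `J₀(r) ≥ 1 - r²/4`. -/
lemma norm_extension_one_ge (ξ : Plane) :
    2 * Real.pi * (1 - ‖ξ‖ ^ 2 / 4) ≤ ‖extension 1 ξ‖ := by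
  have hfin : ∀ g : ℝ → ℝ, Continuous g → IntegrableOn g (Set.Ioo (-Real.pi) Real.pi) :=
    fun g hg => hg.integrableOn_Icc.mono_set Set.Ioo_subset_Icc_self
  have hre : (extension 1 ξ).re =
      ∫ θ in Set.Ioo (-Real.pi) Real.pi, Real.cos (‖ξ‖ * Real.cos θ) := by
    rw [extension_one_eq, ← RCLike.re_eq_complex_re, ← integral_re]
    · refine integral_congr_ae (ae_of_all _ fun θ => ?_)
      simp only [RCLike.re_eq_complex_re]
      rw [neg_mul, ← mul_neg, ← Complex.ofReal_neg, mul_comm, Complex.exp_ofReal_mul_I_re,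
        Real.cos_neg]
    · refine Continuous.integrableOn_Icc (by fun_prop) |>.mono_set Set.Ioo_subset_Icc_self
  have hcos : ∫ θ in Set.Ioo (-Real.pi) Real.pi, Real.cos θ ^ 2 = Real.pi := by
    rw [← integral_Ioc_eq_integral_Ioo,
      ← intervalIntegral.integral_of_le (by linarith [Real.pi_pos]), integral_cos_sq]
    simp
  have hlow : ∫ θ in Set.Ioo (-Real.pi) Real.pi, (1 - ‖ξ‖ ^ 2 / 2 * Real.cos θ ^ 2) =
      2 * Real.pi * (1 - ‖ξ‖ ^ 2 / 4) := by
    rw [integral_sub (hfin _ (by fun_prop)) (hfin _ (by fun_prop)), integral_const_mul, hcos]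
    simp [Real.pi_pos.le]
    ring
  refine le_trans ?_ (Complex.re_le_norm _)
  rw [hre, ← hlow]
  refine integral_mono (hfin _ (by fun_prop)) (hfin _ (by fun_prop)) fun θ => ?_
  have := Real.one_sub_sq_div_two_le_cos (x := ‖ξ‖ * Real.cos θ)
  simp only
  linarith [mul_pow ‖ξ‖ (Real.cos θ) 2]

/-- The minorant of `norm_extension_one_ge`, integrated over the disc of radius `2`, where it is
positive. -/
lemma lintegral_bessel_minorant :
    ENNReal.ofReal ((2 * Real.pi) ^ 7 * (2 / 7)) ≤ ∫⁻ ξ, ‖extension 1 ξ‖ₑ ^ 6 := by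
  have hint : ∫ r in Set.Ioo (0 : ℝ) 2, (2 * Real.pi) ^ 7 * ((1 - r ^ 2 / 4) ^ 6 * r) =
      (2 * Real.pi) ^ 7 * (2 / 7) := by
    rw [integral_const_mul, ← integral_Ioc_eq_integral_Ioo,
      ← intervalIntegral.integral_of_le (by norm_num)]
    congr 1
    have hd : ∀ r ∈ Set.uIcc (0 : ℝ) 2,
        HasDerivAt (fun r : ℝ => -(2 / 7) * (1 - r ^ 2 / 4) ^ 7) ((1 - r ^ 2 / 4) ^ 6 * r) r := by
      intro r _
      have := ((((hasDerivAt_id r).pow 2).div_const 4).const_sub 1).pow 7 |>.const_mul (-(2 / 7))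
      refine this.congr_deriv ?_
      simp
      ring
    rw [intervalIntegral.integral_eq_sub_of_hasDerivAt hd
      (Continuous.intervalIntegrable (by fun_prop) _ _)]
    norm_num
  have hm : Measurable fun ξ : Plane =>
      ENNReal.ofReal (2 * Real.pi * (1 - ‖ξ‖ ^ 2 / 4)) ^ 6 := by fun_prop
  calc _ = ∫⁻ r in Set.Ioo (0 : ℝ) 2,
        ENNReal.ofReal ((2 * Real.pi) ^ 7 * ((1 - r ^ 2 / 4) ^ 6 * r)) := by
        rw [← hint, ofReal_integral_eq_lintegral_ofReal]
        · exact (Continuous.integrableOn_Icc (by fun_prop)).mono_set Set.Ioo_subset_Icc_self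
        · filter_upwards [ae_restrict_mem measurableSet_Ioo] with r hr
          have := hr.1.le
          have := Real.pi_pos
          positivity
    _ = ∫⁻ r in Set.Ioo (0 : ℝ) 2, ENNReal.ofReal r * ∫⁻ x : Circle1,
          ENNReal.ofReal (2 * Real.pi * (1 - ‖r • (x : Plane)‖ ^ 2 / 4)) ^ 6 ∂sigma := by
        refine setLIntegral_congr_fun measurableSet_Ioo fun r hr => ?_
        have h4 : 0 ≤ 1 - r ^ 2 / 4 := by nlinarith [hr.1, hr.2]
        have hp := Real.pi_pos
        have hn : ∀ x : Circle1, ‖r • (x : Plane)‖ ^ 2 = r ^ 2 := by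
          intro x; rw [norm_smul]; simp
        simp_rw [hn]
        rw [lintegral_const, sigma_univ, ← ENNReal.ofReal_pow (by positivity),
          ← ENNReal.ofReal_mul (by positivity), ← ENNReal.ofReal_mul hr.1.le]
        congr 1
        ring
    _ ≤ ∫⁻ r in Set.Ioi (0 : ℝ), ENNReal.ofReal r * ∫⁻ x : Circle1,
          ENNReal.ofReal (2 * Real.pi * (1 - ‖r • (x : Plane)‖ ^ 2 / 4)) ^ 6 ∂sigma :=
        lintegral_mono_set fun r hr => hr.1
    _ = ∫⁻ ξ, ENNReal.ofReal (2 * Real.pi * (1 - ‖ξ‖ ^ 2 / 4)) ^ 6 :=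
        (lintegral_plane_polar hm).symm
    _ ≤ _ := by
        gcongr with ξ
        rw [← ofReal_norm]
        exact ENNReal.ofReal_le_ofReal (norm_extension_one_ge ξ)

/-- Constant functions beat concentration at a pair of antipodal points. -/
theorem five_halves_arcConst_lt : ENNReal.ofReal (5 / 2 * arcConst) < optimalConstant ^ 6 := by
  have h1 : MemLp (1 : Circle1 → ℂ) 2 sigma := memLp_const 1
  have h2 := pow_six_le_iff.2 (eLpNorm_extension_le h1)
  rw [mul_pow, eLpNorm_six_pow, show eLpNorm (1 : Circle1 → ℂ) 2 sigma ^ 6 =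
    (eLpNorm (1 : Circle1 → ℂ) 2 sigma ^ 2) ^ 3 by ring, eLpNorm_two_pow] at h2
  simp only [Pi.one_apply, enorm_one, one_pow, lintegral_const, sigma_univ, one_mul] at h2
  have h3 := lintegral_bessel_minorant.trans h2
  have hp := Real.pi_pos
  by_contra hle
  rw [not_lt] at hle
  have h4 := h3.trans (mul_le_mul_left hle _)
  have hA : 0 < arcConst := by unfold arcConst convConst; positivity
  rw [← ENNReal.ofReal_pow (by positivity), ← ENNReal.ofReal_mul (by positivity),
    ENNReal.ofReal_le_ofReal_iff (by positivity)] at h4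
  -- The claim amounts to `200 √3 / 27 < 32 π / 7`.
  have hs : √3 < 1.7321 := by
    rw [Real.sqrt_lt' (by norm_num)]; norm_num
  have hpi := Real.pi_gt_d2
  unfold arcConst convConst at h4
  have h5 : (2 * Real.pi) ^ 3 * (Real.pi ^ 3 * (32 / 7 * Real.pi)) ≤
      (2 * Real.pi) ^ 3 * (Real.pi ^ 3 * (200 / 27 * √3)) := by
    nlinarith [h4]
  have h6 := le_of_mul_le_mul_left h5 (by positivity)
  have h7 := le_of_mul_le_mul_left h6 (by positivity)
  linarith

/-! ### Exclusion of concentration -/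

lemma extension_reflect {p : Circle1 → ℂ} (hreal : ∀ x, conj (p x) = p x) (ξ : Plane) :
    extension (fun x => p (-x)) ξ = conj (extension p ξ) := by
  have hemb : MeasurableEmbedding (fun x : Circle1 => -x) :=
    (Homeomorph.neg Circle1).measurableEmbedding
  have h := measurePreserving_neg_sigma.integral_comp hemb (fun x =>
    Complex.exp (-Complex.I * ((inner ℝ ξ (-x : Plane) : ℝ) : ℂ)) * p x)
  have h2 : extension (fun x => p (-x)) ξ = ∫ x : Circle1,
      Complex.exp (-Complex.I * ((inner ℝ ξ (-x : Plane) : ℝ) : ℂ)) * p x ∂sigma := by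
    rw [← h]
    simp [extension]
  rw [h2, extension_eq, extensionOf, conj_osc, osc]
  simp [hreal]

lemma memLp_reflect {p : Circle1 → ℂ} (hp : MemLp p 2 sigma) :
    MemLp (fun x => p (-x)) 2 sigma := hp.comp_measurePreserving measurePreserving_neg_sigma

lemma eLpNorm_reflect {p : Circle1 → ℂ} (hp : MemLp p 2 sigma) :
    eLpNorm (fun x => p (-x)) 2 sigma = eLpNorm p 2 sigma :=
  eLpNorm_comp_measurePreserving hp.1 measurePreserving_neg_sigma

/-- The extension inequality for even real functions carried by two antipodal short arcs: the
factor is `20 / 8 = 5 / 2`. -/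
lemma eLpNorm_extension_even_le (z : Circle1) {p : Circle1 → ℂ} (hp : MemLp p 2 sigma)
    (hreal : ∀ x, conj (p x) = p x) (hsupp : ∀ x, x ∉ Metric.ball z (1 / 20) → p x = 0)
    (hmass : 2 * ∫⁻ x, ‖p x‖ₑ ^ 2 ∂sigma ≤ 1) :
    eLpNorm (extension (p + fun x => p (-x))) 6 volume ^ 6 ≤ ENNReal.ofReal (5 / 2 * arcConst) := by
  have hA : 0 ≤ arcConst := by unfold arcConst convConst; positivity
  rw [extension_add (integrable_of_memLp_two hp) (integrable_of_memLp_two (memLp_reflect hp)), eLpNorm_six_pow]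
  simp only [Pi.add_apply, extension_reflect hreal]
  refine (lintegral_add_conj_pow_le z (integrable_of_memLp_two hp) hsupp).trans ?_
  have h1 := lintegral_extension_pow_le_of_arc z (integrable_of_memLp_two hp) hsupp
  have h2 : ∫⁻ x, ‖p x‖ₑ ^ 2 ∂sigma ≤ ENNReal.ofReal (1 / 2) := by
    rw [one_div, ENNReal.ofReal_inv_of_pos two_pos, ENNReal.ofReal_ofNat,
      ENNReal.le_inv_iff_mul_le, mul_comm]
    exact hmass
  calc _ ≤ 20 * (ENNReal.ofReal arcConst * ENNReal.ofReal (1 / 2) ^ 3) := by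
        gcongr
        exact h1.trans (by gcongr)
    _ = ENNReal.ofReal (5 / 2 * arcConst) := by
        rw [← ENNReal.ofReal_pow (by norm_num), ← ENNReal.ofReal_mul hA,
          ← ENNReal.ofReal_ofNat 20, ← ENNReal.ofReal_mul (by norm_num)]
        congr 1
        ring

lemma neg_notMem_ball {z x : Circle1} (hx : x ∈ Metric.ball z (1 / 20)) :
    -x ∉ Metric.ball z (1 / 20) := by
  intro h
  have h1 := (inner_ge_of_mem_ball hx).1
  have h2 := (inner_ge_of_mem_ball h).1
  have h3 : ((-x : Circle1) : Plane) = -(x : Plane) := rfl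
  rw [h3, inner_neg_left] at h2
  linarith

/-- Half of the mass of an even function is an upper bound for its mass on a short arc. -/
lemma two_mul_lintegral_arc_le (z : Circle1) {h : Circle1 → ℂ} (hh : MemLp h 2 sigma)
    (heven : ∀ᵐ x ∂sigma, h (-x) = h x) :
    2 * ∫⁻ x, ‖(Metric.ball z (1 / 20)).indicator h x‖ₑ ^ 2 ∂sigma ≤ ∫⁻ x, ‖h x‖ₑ ^ 2 ∂sigma := by
  set B := Metric.ball z (1 / 20) with hB
  have hBm : MeasurableSet B := Metric.isOpen_ball.measurableSet
  have hp : MemLp (B.indicator h) 2 sigma := hh.indicator hBm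
  have h1 : ∫⁻ x, ‖B.indicator h (-x)‖ₑ ^ 2 ∂sigma = ∫⁻ x, ‖B.indicator h x‖ₑ ^ 2 ∂sigma := by
    have := eLpNorm_reflect hp
    rw [← eLpNorm_two_pow, ← eLpNorm_two_pow, this]
  rw [two_mul]
  conv_lhs => arg 2; rw [← h1]
  rw [← lintegral_add_left' (hp.1.enorm.pow_const 2)]
  refine lintegral_mono_ae ?_
  filter_upwards [heven] with x hx
  by_cases hxB : x ∈ B
  · rw [Set.indicator_of_mem hxB, Set.indicator_of_notMem (neg_notMem_ball hxB)]
    simp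
  · rw [Set.indicator_of_notMem hxB]
    by_cases hxB' : -x ∈ B
    · rw [Set.indicator_of_mem hxB', hx]; simp
    · rw [Set.indicator_of_notMem hxB']; simp

/-- The sixth root of the bound for functions carried by two antipodal short arcs. -/
def concentrationNorm : ℝ≥0∞ := ENNReal.ofReal (5 / 2 * arcConst) ^ (1 / 6 : ℝ)

lemma concentrationNorm_pow : concentrationNorm ^ 6 = ENNReal.ofReal (5 / 2 * arcConst) := by
  unfold concentrationNorm
  rw [← ENNReal.rpow_natCast, ← ENNReal.rpow_mul]
  norm_num

lemma concentrationNorm_lt : concentrationNorm < optimalConstant := by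
  have h := five_halves_arcConst_lt
  rw [← concentrationNorm_pow] at h
  exact (ENNReal.pow_right_strictMono (by norm_num : 6 ≠ 0)).lt_iff_lt.1 h

lemma setLIntegral_enorm_sq_le {g : Circle1 → ℂ} {S : Set Circle1}
    (hg : MemLp g 2 sigma) {t : ℝ} (ht : ∫ x in S, ‖g x‖ ^ 2 ∂sigma ≤ t) :
    ∫⁻ x in S, ‖g x‖ₑ ^ 2 ∂sigma ≤ ENNReal.ofReal t := by
  have hi : Integrable (fun x => ‖g x‖ ^ 2) (sigma.restrict S) :=
    ((memLp_two_iff_integrable_sq_norm hg.1).1 hg).restrict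
  refine le_trans (le_of_eq ?_) (ENNReal.ofReal_le_ofReal ht)
  rw [ofReal_integral_eq_lintegral_ofReal hi (ae_of_all _ fun x => by positivity)]
  refine lintegral_congr fun x => ?_
  rw [ENNReal.ofReal_pow (norm_nonneg _), ofReal_norm]

/-- An upper even-normalized function of norm one with respect to a small cap is, up to a small
error, carried by two antipodal short arcs. -/
theorem eLpNorm_extension_le_of_small_cap {K : ℝ≥0} {Θ : ℝ → ℝ} {c : Cap} {h : Circle1 → ℂ}
    (hh : UpperEvenNormalized K Θ c h) (hmem : MemLp h 2 sigma) (hreal : ∀ x, conj (h x) = h x)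
    (hone : eLpNorm h 2 sigma = 1) {R : ℝ} (hR : 1 ≤ R) (hRr : R * c.radius ≤ 1 / 20) :
    eLpNorm (extension h) 6 volume ≤
      concentrationNorm + optimalConstant * (2 * ENNReal.ofReal (Θ R) ^ (1 / 2 : ℝ)) := by
  obtain ⟨heven, g, hg, hgh⟩ := hh
  have heven' : ∀ᵐ x ∂sigma, h (-x) = h x := by
    filter_upwards [heven] with x hx
    rw [← hx, hreal]
  set z := c.center
  set B := Metric.ball z (1 / 20) with hB
  have hBm : MeasurableSet B := Metric.isOpen_ball.measurableSet
  set p := B.indicator h with hpdef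
  have hp : MemLp p 2 sigma := hmem.indicator hBm
  have hpreal : ∀ x, conj (p x) = p x := by
    intro x
    by_cases hx : x ∈ B <;> simp [p, hx, hreal]
  set q : Circle1 → ℂ := p + fun x => p (-x) with hq
  have hqm : MemLp q 2 sigma := hp.add (memLp_reflect hp)
  have hmass : 2 * ∫⁻ x, ‖p x‖ₑ ^ 2 ∂sigma ≤ 1 := by
    refine (two_mul_lintegral_arc_le z hmem heven').trans ?_
    rw [← eLpNorm_two_pow, hone, one_pow]
  have hq6 : eLpNorm (extension q) 6 volume ≤ concentrationNorm := by
    rw [← pow_six_le_iff, concentrationNorm_pow]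
    exact eLpNorm_extension_even_le z hp hpreal (fun x hx => Set.indicator_of_notMem hx _) hmass
  set S : Set Circle1 := {x | R * c.radius ≤ dist x c.center} with hS
  have hSm : MeasurableSet S := measurableSet_le measurable_const (by fun_prop)
  set g' := S.indicator g with hg'
  have hg'm : MemLp g' 2 sigma := hg.memLp.indicator hSm
  have hg'n : eLpNorm g' 2 sigma ≤ ENNReal.ofReal (Θ R) ^ (1 / 2 : ℝ) := by
    rw [one_div, ENNReal.le_rpow_inv_iff two_pos, ENNReal.rpow_two, eLpNorm_two_pow]
    refine le_trans (le_of_eq ?_) (setLIntegral_enorm_sq_le hg.memLp (hg.tail R hR))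
    rw [← lintegral_indicator hSm]
    refine lintegral_congr fun x => ?_
    by_cases hx : x ∈ S <;> simp [g', hx]
  have hd : eLpNorm (h - q) 2 sigma ≤ 2 * ENNReal.ofReal (Θ R) ^ (1 / 2 : ℝ) := by
    calc eLpNorm (h - q) 2 sigma
        ≤ eLpNorm ((fun x => ‖g' x‖) + fun x => ‖g' (-x)‖) 2 sigma := by
          refine eLpNorm_mono_ae_real ?_
          filter_upwards [hgh, heven'] with x hx hxe
          simp only [Pi.sub_apply, Pi.add_apply, hq, p]
          by_cases hxB : x ∈ B
          · rw [Set.indicator_of_mem hxB, Set.indicator_of_notMem (neg_notMem_ball hxB)]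
            simp only [add_zero, sub_self, norm_zero]; positivity
          · rw [Set.indicator_of_notMem hxB]
            by_cases hxB' : -x ∈ B
            · rw [Set.indicator_of_mem hxB', hxe]
              simp only [zero_add, sub_self, norm_zero]; positivity
            · rw [Set.indicator_of_notMem hxB', add_zero, sub_zero, hx]
              have hmemS : ∀ y : Circle1, y ∉ B → y ∈ S := by
                intro y hy
                rw [hB, Metric.mem_ball, not_lt] at hy
                exact hRr.trans hy
              rw [hg', Set.indicator_of_mem (hmemS x hxB), Set.indicator_of_mem (hmemS _ hxB')]
              exact norm_add_le _ _
      _ ≤ eLpNorm g' 2 sigma + eLpNorm (fun x => g' (-x)) 2 sigma := by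
          rw [← eLpNorm_norm g', ← eLpNorm_norm (fun x => g' (-x))]
          exact eLpNorm_add_le hg'm.1.norm (memLp_reflect hg'm).1.norm (by norm_num)
      _ ≤ _ := by
          rw [eLpNorm_reflect hg'm, ← two_mul]
          gcongr
  have hsplit : extension h = extension q + extension (h - q) := by
    rw [← extension_add (integrable_of_memLp_two hqm) (integrable_of_memLp_two (hmem.sub hqm)), add_sub_cancel]
  rw [hsplit]
  refine (eLpNorm_add_le ?_ ?_ (by norm_num)).trans (add_le_add hq6 ?_)
  · exact (continuous_extension (integrable_of_memLp_two hqm)).aestronglyMeasurable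
  · exact (continuous_extension (integrable_of_memLp_two (hmem.sub hqm))).aestronglyMeasurable
  · refine (eLpNorm_extension_le (hmem.sub hqm)).trans ?_
    gcongr

lemma memLp_modulus {f : Circle1 → ℂ} (hf : MemLp f 2 sigma) : MemLp (modulus f) 2 sigma :=
  hf.norm.ofReal

lemma eLpNorm_modulus (f : Circle1 → ℂ) : eLpNorm (modulus f) 2 sigma = eLpNorm f 2 sigma :=
  eLpNorm_congr_norm_ae (ae_of_all _ fun x => by simp [modulus])

lemma conj_modulus (f : Circle1 → ℂ) (x : Circle1) : conj (modulus f x) = modulus f x :=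
  Complex.conj_ofReal _

lemma eLpNorm_extension_le_modulus {f : Circle1 → ℂ} (hf : MemLp f 2 sigma) :
    eLpNorm (extension f) 6 volume ≤ eLpNorm (extension (modulus f)) 6 volume := by
  rw [← pow_six_le_iff, eLpNorm_six_pow, eLpNorm_six_pow]
  exact lintegral_extension_pow_le_modulus (integrable_of_memLp_two hf)

lemma exists_pos_le_of_eventually {r : ℕ → ℝ} (hr : ∀ n, 0 < r n) {m : ℝ} (hm : 0 < m)
    (h : ∀ᶠ n in atTop, m ≤ r n) : ∃ m' > 0, ∀ n, m' ≤ r n := by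
  obtain ⟨N, hN⟩ := eventually_atTop.1 h
  have hfin : ∀ N : ℕ, ∃ m' > 0, ∀ n < N, m' ≤ r n := by
    intro N
    induction N with
    | zero => exact ⟨1, one_pos, by simp⟩
    | succ N ih =>
      obtain ⟨m', h0, h1⟩ := ih
      refine ⟨min m' (r N), lt_min h0 (hr N), fun n hn => ?_⟩
      rcases Nat.lt_succ_iff_lt_or_eq.1 hn with h | rfl
      · exact (min_le_left _ _).trans (h1 n h)
      · exact min_le_right _ _
  obtain ⟨m', h0, h1⟩ := hfin N
  refine ⟨min m m', lt_min hm h0, fun n => ?_⟩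
  rcases lt_or_ge n N with h | h
  · exact (min_le_right _ _).trans (h1 n h)
  · exact (min_le_left _ _).trans (hN n h)

/-- Extremizing sequences do not concentrate. -/
theorem exists_radius_lower_bound {f : ℕ → Circle1 → ℂ} (hf : IsExtremizingSeq f)
    {c : ℕ → Cap} {K : ℝ≥0} {Θ : ℝ → ℝ} (hΘ : Tendsto Θ atTop (𝓝 0))
    (hnorm : ∀ ν, UpperEvenNormalized K Θ (c ν) (modulus (f ν))) :
    ∃ m > 0, ∀ ν, m ≤ (c ν).radius := by
  have hlim : Tendsto (fun R => concentrationNorm +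
      optimalConstant * (2 * ENNReal.ofReal (Θ R) ^ (1 / 2 : ℝ))) atTop (𝓝 concentrationNorm) := by
    have h1 : Tendsto (fun R => ENNReal.ofReal (Θ R) ^ (1 / 2 : ℝ)) atTop (𝓝 0) := by
      have := (ENNReal.tendsto_ofReal hΘ).ennrpow_const (1 / 2 : ℝ)
      simpa using this
    have h2 := ENNReal.Tendsto.const_mul (a := 2) h1 (Or.inr ENNReal.ofNat_ne_top)
    have h3 := ENNReal.Tendsto.const_mul (a := optimalConstant) h2 (Or.inr optimalConstant_ne_top)
    simpa using tendsto_const_nhds.add h3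
  obtain ⟨R, hRlt, hR1⟩ :=
    ((hlim.eventually_lt_const concentrationNorm_lt).and (eventually_ge_atTop 1)).exists
  refine exists_pos_le_of_eventually (fun ν => (c ν).radius_pos) (m := 1 / (20 * R))
    (by positivity) ?_
  filter_upwards [hf.tendsto.eventually_const_lt hRlt] with ν hν
  by_contra hlt
  rw [not_le, lt_div_iff₀ (by positivity)] at hlt
  refine absurd hν (not_lt.2 ((eLpNorm_extension_le_modulus (hf.memLp ν)).trans ?_))
  exact eLpNorm_extension_le_of_small_cap (hnorm ν) (memLp_modulus (hf.memLp ν)) (conj_modulus _)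
    (by rw [eLpNorm_modulus, hf.norm_eq_one]) hR1 (by linarith)

/-! ### Weak limits and the Brezis–Lieb splitting -/

/-- Bounded sequences in a separable Hilbert space have weakly convergent subsequences. -/
lemma exists_weak_limit {E : Type*} [NormedAddCommGroup E] [InnerProductSpace ℂ E] [CompleteSpace E]
    [TopologicalSpace.SeparableSpace E] {u : ℕ → E} (hu : ∀ n, ‖u n‖ ≤ 1) :
    ∃ (w : E) (φ : ℕ → ℕ), StrictMono φ ∧
      ∀ v, Tendsto (fun n => inner ℂ (u (φ n)) v) atTop (𝓝 (inner ℂ w v)) := by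
  obtain ⟨a, -, φ, hφ, ha⟩ := WeakDual.isSeqCompact_closedBall ℂ E 0 1
    (x := fun n => StrongDual.toWeakDual (InnerProductSpace.toDual ℂ E (u n)))
    (fun n => by simpa using hu n)
  refine ⟨(InnerProductSpace.toDual ℂ E).symm (WeakDual.toStrongDual a), φ, hφ, fun v => ?_⟩
  rw [InnerProductSpace.toDual_symm_apply]
  exact ((WeakDual.eval_continuous v).tendsto a).comp ha

lemma add_pow_six_le {a b t : ℝ} (ha : 0 ≤ a) (hb : 0 ≤ b) (ht : t ∈ Set.Ioo (0 : ℝ) 1) :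
    (a + b) ^ 6 ≤ ((1 - t) ^ 5)⁻¹ * a ^ 6 + (t ^ 5)⁻¹ * b ^ 6 := by
  obtain ⟨h0, h1⟩ := ht
  have h1' : 0 < 1 - t := by linarith
  have h := (convexOn_pow 6).2 (x := a / (1 - t)) (y := b / t) (Set.mem_Ici.2 (by positivity))
    (Set.mem_Ici.2 (by positivity)) h1'.le h0.le (by ring)
  simp only [smul_eq_mul] at h
  rw [mul_div_cancel₀ _ h1'.ne', mul_div_cancel₀ _ h0.ne'] at h
  refine h.trans (le_of_eq ?_)
  field_simp

/-- One half of the Brezis–Lieb lemma in `L⁶`. -/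
lemma exists_brezis_lieb {T : Type*} [MeasurableSpace T] {μ : Measure T} {F : ℕ → T → ℂ} {G : T → ℂ}
    (hF : ∀ n, Measurable (F n)) (hG : Measurable G) (hGfin : ∫⁻ x, ‖G x‖ₑ ^ 6 ∂μ ≠ ∞)
    (hlim : ∀ x, Tendsto (fun n => F n x) atTop (𝓝 (G x))) {t : ℝ} (ht : t ∈ Set.Ioo (0 : ℝ) 1) :
    ∃ o : ℕ → ℝ≥0∞, Tendsto o atTop (𝓝 0) ∧ ∀ n, ∫⁻ x, ‖F n x‖ₑ ^ 6 ∂μ ≤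
      o n + (ENNReal.ofReal (((1 - t) ^ 5)⁻¹) * ∫⁻ x, ‖F n x - G x‖ₑ ^ 6 ∂μ +
        ∫⁻ x, ‖G x‖ₑ ^ 6 ∂μ) := by
  have ht1 : 0 < 1 - t := by linarith [ht.2]
  have ht0 := ht.1
  set A := ENNReal.ofReal (((1 - t) ^ 5)⁻¹) with hA
  set B := ENNReal.ofReal ((t ^ 5)⁻¹) with hB
  -- The truncated subtraction makes `W n` the positive part, which `B |G|⁶` dominates.
  set W : ℕ → T → ℝ≥0∞ := fun n x => ‖F n x‖ₑ ^ 6 - (A * ‖F n x - G x‖ₑ ^ 6 + ‖G x‖ₑ ^ 6) with hW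
  have hWm : ∀ n, Measurable (W n) := fun n => by
    have := hF n
    simp only [hW]
    fun_prop
  have hdom : ∀ n x, ‖F n x‖ₑ ^ 6 ≤ A * ‖F n x - G x‖ₑ ^ 6 + B * ‖G x‖ₑ ^ 6 := by
    intro n x
    have h1 : ‖F n x‖ ^ 6 ≤
        ((1 - t) ^ 5)⁻¹ * ‖F n x - G x‖ ^ 6 + (t ^ 5)⁻¹ * ‖G x‖ ^ 6 := by
      refine le_trans ?_ (add_pow_six_le (norm_nonneg _) (norm_nonneg _) ht)
      gcongr
      simpa using norm_add_le (F n x - G x) (G x)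
    have h2 := ENNReal.ofReal_le_ofReal h1
    rwa [ENNReal.ofReal_add (by positivity) (by positivity), ENNReal.ofReal_mul (by positivity),
      ENNReal.ofReal_mul (by positivity), ENNReal.ofReal_pow (norm_nonneg _),
      ENNReal.ofReal_pow (norm_nonneg _), ENNReal.ofReal_pow (norm_nonneg _), ofReal_norm,
      ofReal_norm, ofReal_norm] at h2
  have hpt : ∀ x, Tendsto (fun n => W n x) atTop (𝓝 0) := by
    intro x
    have h1 : Tendsto (fun n => ‖F n x‖ₑ ^ 6) atTop (𝓝 (‖G x‖ₑ ^ 6)) :=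
      (ENNReal.continuous_pow 6).tendsto _ |>.comp ((hlim x).enorm)
    have h2 : Tendsto (fun n => ‖F n x - G x‖ₑ ^ 6) atTop (𝓝 0) := by
      have h3 : Tendsto (fun n => F n x - G x) atTop (𝓝 0) := by
        simpa using (hlim x).sub_const (G x)
      have := (ENNReal.continuous_pow 6).tendsto _ |>.comp h3.enorm
      simpa [Function.comp_def] using this
    have h3 : Tendsto (fun n => A * ‖F n x - G x‖ₑ ^ 6 + ‖G x‖ₑ ^ 6) atTop (𝓝 (‖G x‖ₑ ^ 6)) := by
      have := (ENNReal.Tendsto.const_mul (a := A) h2 (Or.inr ENNReal.ofReal_ne_top)).add_const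
        (‖G x‖ₑ ^ 6)
      simpa using this
    have := ENNReal.Tendsto.sub h1 h3 (Or.inl (by finiteness))
    simpa [hW] using this
  refine ⟨fun n => ∫⁻ x, W n x ∂μ, ?_, fun n => ?_⟩
  · have := tendsto_lintegral_of_dominated_convergence (μ := μ) (F := W) (f := fun _ => 0)
      (fun x => B * ‖G x‖ₑ ^ 6) hWm ?_ ?_ (ae_of_all _ hpt)
    · simpa using this
    · refine fun n => ae_of_all _ fun x => ?_
      simp only [hW]
      rw [tsub_le_iff_left]
      refine (hdom n x).trans ?_
      gcongr
      exact le_self_add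
    · rw [lintegral_const_mul _ (by fun_prop)]
      exact ENNReal.mul_ne_top ENNReal.ofReal_ne_top hGfin
  · have hm1 : Measurable fun x => A * ‖F n x - G x‖ₑ ^ 6 := by
      have := hF n; fun_prop
    have hm2 : Measurable fun x => ‖F n x - G x‖ₑ ^ 6 := by
      have := hF n; fun_prop
    rw [← lintegral_const_mul _ hm2, ← lintegral_add_left hm1, ← lintegral_add_left (hWm n)]
    exact lintegral_mono fun x => le_tsub_add

/-- Square-integrable functions on the circle. -/
abbrev L2Circle : Type := Lp ℂ 2 sigma

/-- The plane wave with frequency `ξ`, restricted to the circle. -/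
def planeWave (ξ : Plane) : L2Circle :=
  MemLp.toLp (fun x : Circle1 => Complex.exp (Complex.I * ((inner ℝ ξ (x : Plane) : ℝ) : ℂ))) <| by
    refine MemLp.of_bound (Measurable.aestronglyMeasurable (by fun_prop)) 1 (ae_of_all _ fun x => ?_)
    rw [Complex.norm_exp]; simp

lemma inner_planeWave (ξ : Plane) (v : L2Circle) :
    inner ℂ (planeWave ξ) v = extension v ξ := by
  rw [L2.inner_def]
  refine integral_congr_ae ?_
  filter_upwards [MemLp.coeFn_toLp (f := fun x : Circle1 =>
    Complex.exp (Complex.I * ((inner ℝ ξ (x : Plane) : ℝ) : ℂ))) (p := 2) (μ := sigma) <| by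
    refine MemLp.of_bound (Measurable.aestronglyMeasurable (by fun_prop)) 1 (ae_of_all _ fun x => ?_)
    rw [Complex.norm_exp]; simp] with x hx
  rw [planeWave, hx, RCLike.inner_apply, mul_comm]
  congr 1
  rw [← Complex.exp_conj, map_mul, Complex.conj_I, Complex.conj_ofReal]

lemma eLpNorm_eq_ofReal_norm (v : L2Circle) : eLpNorm v 2 sigma = ENNReal.ofReal ‖v‖ := by
  rw [Lp.norm_def, ENNReal.ofReal_toReal (Lp.eLpNorm_ne_top v)]

lemma lintegral_extension_le (v : L2Circle) :
    ∫⁻ ξ, ‖extension v ξ‖ₑ ^ 6 ≤ optimalConstant ^ 6 * ENNReal.ofReal (‖v‖ ^ 6) := by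
  rw [← eLpNorm_six_pow, ENNReal.ofReal_pow (norm_nonneg _), ← eLpNorm_eq_ofReal_norm, ← mul_pow,
    pow_six_le_iff]
  exact eLpNorm_extension_le (Lp.memLp v)

lemma optimalConstant_pos : 0 < optimalConstant :=
  lt_of_le_of_lt zero_le concentrationNorm_lt

lemma extension_Lp_sub (u v : L2Circle) :
    extension (u - v : L2Circle) = extension u - extension v := by
  have h : (u : Circle1 → ℂ) =ᵐ[sigma] ((u - v : L2Circle) : Circle1 → ℂ) + v := by
    filter_upwards [Lp.coeFn_sub u v] with x hx
    rw [Pi.add_apply, hx, Pi.sub_apply, sub_add_cancel]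
  rw [extension_congr h, extension_add (integrable_of_memLp_two (Lp.memLp _))
    (integrable_of_memLp_two (Lp.memLp _)), add_sub_cancel_right]

/-- An extremizing sequence of unit vectors with a nonzero weak limit converges strongly: by the
Brezis–Lieb lemma the sixth powers of the two norms add up, while the extension inequality bounds
them by the cubes of the masses. -/
theorem tendsto_norm_sub_of_weak {u : ℕ → L2Circle} (hu : ∀ n, ‖u n‖ = 1)
    (hext : Tendsto (fun n => eLpNorm (extension (u n)) 6 volume) atTop (𝓝 optimalConstant))
    {w : L2Circle} (hw : ∀ v, Tendsto (fun n => inner ℂ (u n) v) atTop (𝓝 (inner ℂ w v)))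
    (hw0 : w ≠ 0) : Tendsto (fun n => ‖u n - w‖) atTop (𝓝 0) := by
  have hwn : 0 < ‖w‖ := norm_pos_iff.2 hw0
  set a := ‖w‖ ^ 2 with ha
  have ha0 : 0 < a := by positivity
  have hsub : Tendsto (fun n => ‖u n - w‖ ^ 2) atTop (𝓝 (1 - a)) := by
    have h1 : Tendsto (fun n => RCLike.re (inner ℂ (u n) w)) atTop (𝓝 a) := by
      have := (RCLike.continuous_re.tendsto _).comp (hw w)
      rwa [inner_self_eq_norm_sq (𝕜 := ℂ)] at this
    have h2 : ∀ n, ‖u n - w‖ ^ 2 = 1 - 2 * RCLike.re (inner ℂ (u n) w) + a := by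
      intro n
      rw [norm_sub_sq (𝕜 := ℂ), hu, one_pow]
    simp_rw [h2]
    have := (h1.const_mul 2).const_sub 1 |>.add_const a
    convert this using 2
    ring
  have ha1 : a ≤ 1 := by
    have := ge_of_tendsto' hsub fun n => sq_nonneg ‖u n - w‖
    linarith
  have hpt : ∀ ξ, Tendsto (fun n => extension (u n) ξ) atTop (𝓝 (extension w ξ)) := by
    intro ξ
    have := (RCLike.continuous_conj.tendsto _).comp (hw (planeWave ξ))
    simp only [Function.comp_def, inner_conj_symm, inner_planeWave] at this
    exact this
  have hR0 : optimalConstant ^ 6 ≠ 0 := pow_ne_zero _ optimalConstant_pos.ne'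
  have hRt : optimalConstant ^ 6 ≠ ∞ := ENNReal.pow_ne_top optimalConstant_ne_top
  have hmeas : ∀ v : L2Circle, Measurable (extension v) := fun v =>
    (continuous_extension (integrable_of_memLp_two (Lp.memLp v))).measurable
  have hlim6 : Tendsto (fun n => ∫⁻ ξ, ‖extension (u n) ξ‖ₑ ^ 6) atTop (𝓝 (optimalConstant ^ 6)) := by
    simp_rw [← eLpNorm_six_pow]
    exact (ENNReal.continuous_pow 6).tendsto _ |>.comp hext
  have hw6 : ∫⁻ ξ, ‖extension w ξ‖ₑ ^ 6 ≤ optimalConstant ^ 6 * ENNReal.ofReal (a ^ 3) := by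
    refine (lintegral_extension_le w).trans (le_of_eq ?_)
    rw [ha, ← pow_mul]
  have key : ∀ t ∈ Set.Ioo (0 : ℝ) 1, 1 ≤ ((1 - t) ^ 5)⁻¹ * (1 - a) ^ 3 + a ^ 3 := by
    intro t ht
    have ht1 : 0 < 1 - t := by linarith [ht.2]
    obtain ⟨o, ho, hBL⟩ := exists_brezis_lieb (μ := volume) (fun n => hmeas (u n)) (hmeas w)
      (ne_top_of_le_ne_top (ENNReal.mul_ne_top hRt ENNReal.ofReal_ne_top) hw6) hpt ht
    have hbound : ∀ n, ∫⁻ ξ, ‖extension (u n) ξ‖ₑ ^ 6 ≤ o n + (ENNReal.ofReal (((1 - t) ^ 5)⁻¹) *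
        (optimalConstant ^ 6 * ENNReal.ofReal ((‖u n - w‖ ^ 2) ^ 3)) +
          optimalConstant ^ 6 * ENNReal.ofReal (a ^ 3)) := by
      intro n
      refine (hBL n).trans ?_
      gcongr
      refine le_trans (le_of_eq ?_) ((lintegral_extension_le (u n - w)).trans (le_of_eq ?_))
      · rw [extension_Lp_sub]; rfl
      · rw [← pow_mul]
    have hlimR : Tendsto (fun n => o n + (ENNReal.ofReal (((1 - t) ^ 5)⁻¹) *
        (optimalConstant ^ 6 * ENNReal.ofReal ((‖u n - w‖ ^ 2) ^ 3)) +
          optimalConstant ^ 6 * ENNReal.ofReal (a ^ 3))) atTop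
        (𝓝 (0 + (ENNReal.ofReal (((1 - t) ^ 5)⁻¹) *
        (optimalConstant ^ 6 * ENNReal.ofReal ((1 - a) ^ 3)) +
          optimalConstant ^ 6 * ENNReal.ofReal (a ^ 3)))) := by
      refine ho.add (Tendsto.add_const _ ?_)
      refine ENNReal.Tendsto.const_mul ?_ (Or.inr ENNReal.ofReal_ne_top)
      exact ENNReal.Tendsto.const_mul (ENNReal.tendsto_ofReal (hsub.pow 3)) (Or.inr hRt)
    have h := le_of_tendsto_of_tendsto' hlim6 hlimR hbound
    have h1a : 0 ≤ 1 - a := by linarith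
    have heq : 0 + (ENNReal.ofReal (((1 - t) ^ 5)⁻¹) *
        (optimalConstant ^ 6 * ENNReal.ofReal ((1 - a) ^ 3)) +
          optimalConstant ^ 6 * ENNReal.ofReal (a ^ 3)) =
        optimalConstant ^ 6 * ENNReal.ofReal (((1 - t) ^ 5)⁻¹ * (1 - a) ^ 3 + a ^ 3) := by
      rw [ENNReal.ofReal_add (by positivity) (by positivity), ENNReal.ofReal_mul (by positivity)]
      ring
    rw [heq] at h
    nth_rewrite 1 [← mul_one (optimalConstant ^ 6)] at h
    rw [ENNReal.mul_le_mul_iff_right hR0 hRt] at h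
    exact ENNReal.one_le_ofReal.1 h
  have hfin : 1 ≤ (1 - a) ^ 3 + a ^ 3 := by
    have h1 : Tendsto (fun t : ℝ => ((1 - t) ^ 5)⁻¹ * (1 - a) ^ 3 + a ^ 3) (𝓝[>] 0)
        (𝓝 (((1 - 0 : ℝ) ^ 5)⁻¹ * (1 - a) ^ 3 + a ^ 3)) := by
      have hc : ContinuousAt (fun t : ℝ => ((1 - t) ^ 5)⁻¹ * (1 - a) ^ 3 + a ^ 3) 0 := by
        refine ContinuousAt.add (ContinuousAt.mul (ContinuousAt.inv₀ ?_ ?_) ?_) ?_ <;>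
          first | fun_prop | norm_num
      exact hc.tendsto.mono_left nhdsWithin_le_nhds
    have h2 := ge_of_tendsto h1 (by
      filter_upwards [Ioo_mem_nhdsGT (zero_lt_one (α := ℝ))] with t ht using key t ht)
    simpa using h2
  have ha_eq : a = 1 := by
    have : 0 ≤ a * (a - 1) := by nlinarith
    have : 0 ≤ a - 1 := nonneg_of_mul_nonneg_right this ha0
    linarith
  rw [ha_eq, sub_self] at hsub
  have := (Real.continuous_sqrt.tendsto 0).comp hsub
  simpa [Function.comp_def, Real.sqrt_sq (norm_nonneg _)] using this

/-! ### Nonvanishing weak limits and conclusion -/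

/-- A function with an equi-integrable square and a given `L²` norm has an `L¹` norm bounded from
below. -/
lemma one_le_mul_lintegral_enorm_add {K : ℝ≥0} {Θ : ℝ → ℝ} {c : Cap} {h : Circle1 → ℂ}
    (hh : UpperEvenNormalized K Θ c h) (hmem : MemLp h 2 sigma) (hone : eLpNorm h 2 sigma = 1)
    {R A : ℝ} (hR : 1 ≤ R) (hA : R * c.radius ^ (-(1 / 2) : ℝ) ≤ A) :
    1 ≤ ENNReal.ofReal (2 * A) * ∫⁻ x, ‖h x‖ₑ ∂sigma + 8 * ENNReal.ofReal (Θ R) := by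
  obtain ⟨-, g, hg, hgh⟩ := hh
  set S : Set Circle1 := {x | R * c.radius ^ (-(1 / 2) : ℝ) < ‖g x‖} with hS
  have hSm : NullMeasurableSet S sigma :=
    nullMeasurableSet_lt aemeasurable_const hg.memLp.1.norm.aemeasurable
  have hA0 : 0 ≤ A := le_trans (by have := c.radius_pos; positivity) hA
  set G : Circle1 → ℝ≥0∞ := S.indicator fun x => ‖g x‖ₑ ^ 2 with hG
  have hGm : AEMeasurable G sigma := (hg.memLp.1.enorm.pow_const 2).indicator₀ hSm
  have hGi : ∫⁻ x, G x ∂sigma ≤ ENNReal.ofReal (Θ R) :=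
    (lintegral_indicator_le _ _).trans (setLIntegral_enorm_sq_le hg.memLp (hg.height R hR))
  have hGr : ∫⁻ x, G (-x) ∂sigma = ∫⁻ x, G x ∂sigma :=
    measurePreserving_neg_sigma.lintegral_comp_emb (Homeomorph.neg Circle1).measurableEmbedding G
  have hpt : ∀ᵐ x ∂sigma, ‖h x‖ₑ ^ 2 ≤
      ENNReal.ofReal (2 * A) * ‖h x‖ₑ + 4 * (G x + G (-x)) := by
    filter_upwards [hgh] with x hx
    -- If the larger of `|g(x)|`, `|g(-x)|` exceeds the threshold it controls `|h(x)|`.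
    have hbig : ∀ y y' : Circle1, h x = g y + g y' → ‖g y'‖ ≤ ‖g y‖ → y ∈ S →
        ‖h x‖ₑ ^ 2 ≤ 4 * G y := by
      intro y y' hxy hle hy
      rw [hG, Set.indicator_of_mem hy]
      have h1 : ‖h x‖ ^ 2 ≤ 4 * ‖g y‖ ^ 2 := by
        have h2 : ‖h x‖ ≤ 2 * ‖g y‖ := by
          rw [hxy]; exact (norm_add_le _ _).trans (by linarith)
        calc ‖h x‖ ^ 2 ≤ (2 * ‖g y‖) ^ 2 := by gcongr
          _ = 4 * ‖g y‖ ^ 2 := by ring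
      have h3 := ENNReal.ofReal_le_ofReal h1
      rwa [ENNReal.ofReal_mul (by norm_num), ENNReal.ofReal_pow (norm_nonneg _),
        ENNReal.ofReal_pow (norm_nonneg _), ofReal_norm, ofReal_norm, ENNReal.ofReal_ofNat] at h3
    by_cases h1 : ‖g (-x)‖ ≤ ‖g x‖ ∧ x ∈ S
    · refine (hbig x (-x) hx h1.1 h1.2).trans (le_add_left ?_)
      gcongr
      exact le_self_add
    by_cases h2 : ‖g x‖ ≤ ‖g (-x)‖ ∧ -x ∈ S
    · refine (hbig (-x) x (by rw [hx, add_comm]) h2.1 h2.2).trans (le_add_left ?_)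
      gcongr
      exact le_add_self
    refine le_add_right ?_
    rw [pow_two]
    gcongr
    rw [← ofReal_norm]
    apply ENNReal.ofReal_le_ofReal
    have hns : ∀ y, y ∉ S → ‖g y‖ ≤ A := fun y hy => (not_lt.1 hy).trans hA
    rw [hx]
    refine (norm_add_le _ _).trans ?_
    rcases le_total ‖g (-x)‖ ‖g x‖ with hle | hle
    · have := hns x fun hxS => h1 ⟨hle, hxS⟩
      linarith
    · have := hns (-x) fun hxS => h2 ⟨hle, hxS⟩
      linarith
  calc (1 : ℝ≥0∞) = ∫⁻ x, ‖h x‖ₑ ^ 2 ∂sigma := by rw [← eLpNorm_two_pow, hone, one_pow]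
    _ ≤ ∫⁻ x, (ENNReal.ofReal (2 * A) * ‖h x‖ₑ + 4 * (G x + G (-x))) ∂sigma :=
        lintegral_mono_ae hpt
    _ = ENNReal.ofReal (2 * A) * ∫⁻ x, ‖h x‖ₑ ∂sigma +
          4 * (∫⁻ x, G x ∂sigma + ∫⁻ x, G (-x) ∂sigma) := by
        rw [lintegral_add_left' (hmem.1.enorm.const_mul _),
          lintegral_const_mul'' _ hmem.1.enorm, lintegral_const_mul' _ _ ENNReal.ofNat_ne_top,
          lintegral_add_left' hGm]
    _ ≤ _ := by
        rw [hGr, ← two_mul, ← mul_assoc]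
        norm_num
        gcongr

/-- The moduli of an extremizing sequence that is normalized with respect to caps of size bounded
from below do not tend weakly to zero. -/
theorem exists_lower_bound_extension_zero {f : ℕ → Circle1 → ℂ} (hf : IsExtremizingSeq f)
    {c : ℕ → Cap} {K : ℝ≥0} {Θ : ℝ → ℝ} (hΘ : Tendsto Θ atTop (𝓝 0))
    (hnorm : ∀ ν, UpperEvenNormalized K Θ (c ν) (modulus (f ν)))
    {m : ℝ} (hm : 0 < m) (hmc : ∀ ν, m ≤ (c ν).radius) :
    ∃ κ > 0, ∀ ν, κ ≤ ‖extension (modulus (f ν)) 0‖ := by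
  obtain ⟨R, hΘR, hR⟩ := ((hΘ.eventually_le_const (show (0 : ℝ) < 1 / 16 by norm_num)).and
    (eventually_ge_atTop 1)).exists
  -- With `Θ R ≤ 1 / 16` the tail accounts for at most half of the unit mass.
  set A := R * m ^ (-(1 / 2) : ℝ) with hA
  have hA0 : 0 < A := by positivity
  refine ⟨1 / (4 * A), by positivity, fun ν => ?_⟩
  have hmem := memLp_modulus (hf.memLp ν)
  have hAν : R * (c ν).radius ^ (-(1 / 2) : ℝ) ≤ A := by
    refine mul_le_mul_of_nonneg_left ?_ (by linarith)
    exact Real.rpow_le_rpow_of_nonpos hm (hmc ν) (by norm_num)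
  have h1 := one_le_mul_lintegral_enorm_add (hnorm ν) hmem
    (by rw [eLpNorm_modulus, hf.norm_eq_one]) hR hAν
  have hint := integrable_of_memLp_two hmem
  rw [← ofReal_integral_norm_eq_lintegral_enorm hint, ← ENNReal.ofReal_ofNat 8,
    ← ENNReal.ofReal_mul (by positivity), ← ENNReal.ofReal_mul (by norm_num)] at h1
  have h2 : 1 ≤ 2 * A * ∫ x, ‖modulus (f ν) x‖ ∂sigma + 8 * (1 / 16) := by
    have h3 : 0 ≤ ∫ x, ‖modulus (f ν) x‖ ∂sigma := integral_nonneg fun _ => norm_nonneg _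
    rw [← ENNReal.one_le_ofReal, ENNReal.ofReal_add (by positivity) (by norm_num)]
    refine h1.trans ?_
    gcongr
  have h4 : extension (modulus (f ν)) 0 = ((∫ x, ‖modulus (f ν) x‖ ∂sigma : ℝ) : ℂ) := by
    rw [← integral_complex_ofReal]
    simp [extension, modulus]
  rw [h4, Complex.norm_of_nonneg (integral_nonneg fun _ => norm_nonneg _), div_le_iff₀ (by positivity)]
  linarith

instance : TopologicalSpace.SeparableSpace L2Circle :=
  haveI : Fact ((2 : ℝ≥0∞) ≠ ∞) := ⟨ENNReal.ofNat_ne_top⟩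
  haveI : SecondCountableTopology L2Circle := Lp.SecondCountableTopology
  inferInstance

/-- Extremizing sequences that are normalized with respect to caps have caps of size bounded from
below, and their moduli are precompact. -/
theorem radius_pos_and_exists_extremizer {f : ℕ → Circle1 → ℂ} (hf : IsExtremizingSeq f)
    {c : ℕ → Cap} {K : ℝ≥0} {Θ : ℝ → ℝ} (hΘ : Tendsto Θ atTop (𝓝 0))
    (hnorm : ∀ ν, UpperEvenNormalized K Θ (c ν) (modulus (f ν))) :
    0 < ⨅ ν, (c ν).radius ∧
    ∃ (F : Circle1 → ℂ) (φ : ℕ → ℕ), IsExtremizer F ∧ StrictMono φ ∧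
      Tendsto (fun n => eLpNorm (modulus (f (φ n)) - F) 2 sigma) atTop (𝓝 0) := by
  obtain ⟨m, hm, hmc⟩ := exists_radius_lower_bound hf hΘ hnorm
  refine ⟨lt_of_lt_of_le hm (le_ciInf hmc), ?_⟩
  obtain ⟨κ, hκ, hκf⟩ := exists_lower_bound_extension_zero hf hΘ hnorm hm hmc
  have hmem : ∀ n, MemLp (modulus (f n)) 2 sigma := fun n => memLp_modulus (hf.memLp n)
  set u : ℕ → L2Circle := fun n => (hmem n).toLp with hu
  have hcoe : ∀ n, (u n : Circle1 → ℂ) =ᵐ[sigma] modulus (f n) := fun n => MemLp.coeFn_toLp _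
  have hext : ∀ n, extension (u n) = extension (modulus (f n)) := fun n => extension_congr (hcoe n)
  have hunorm : ∀ n, ‖u n‖ = 1 := by
    intro n
    rw [Lp.norm_def, eLpNorm_congr_ae (hcoe n), eLpNorm_modulus, hf.norm_eq_one, ENNReal.toReal_one]
  have hulim : Tendsto (fun n => eLpNorm (extension (u n)) 6 volume) atTop (𝓝 optimalConstant) := by
    refine tendsto_of_tendsto_of_tendsto_of_le_of_le hf.tendsto tendsto_const_nhds (fun n => ?_)
      (fun n => ?_)
    · simp only [hext]
      exact eLpNorm_extension_le_modulus (hf.memLp n)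
    · refine (eLpNorm_extension_le (Lp.memLp (u n))).trans (le_of_eq ?_)
      rw [eLpNorm_eq_ofReal_norm, hunorm, ENNReal.ofReal_one, mul_one]
  obtain ⟨w, φ, hφ, hw⟩ := exists_weak_limit (fun n => (hunorm n).le)
  have hw0 : w ≠ 0 := by
    rintro rfl
    have h1 := (hw (planeWave 0)).norm
    -- The plane wave of frequency zero tests against the integral.
    simp only [norm_inner_symm _ (planeWave 0), inner_planeWave, hext] at h1
    have h2 := ge_of_tendsto' h1 fun n => hκf (φ n)
    rw [← inner_planeWave, inner_zero_right, norm_zero] at h2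
    linarith
  have hstrong := tendsto_norm_sub_of_weak (fun n => hunorm (φ n))
    (hulim.comp hφ.tendsto_atTop) hw hw0
  have hsub : Tendsto (fun n => eLpNorm ((u (φ n) - w : L2Circle) : Circle1 → ℂ) 2 sigma) atTop
      (𝓝 0) := by
    simp_rw [eLpNorm_eq_ofReal_norm]
    simpa using ENNReal.tendsto_ofReal hstrong
  have hwnorm : ‖w‖ = 1 := by
    have h1 : Tendsto (fun n => u (φ n)) atTop (𝓝 w) := tendsto_iff_norm_sub_tendsto_zero.2 hstrong
    have h2 := h1.norm
    simp only [hunorm] at h2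
    exact tendsto_nhds_unique h2 tendsto_const_nhds |>.symm ▸ rfl
  have hw1 : eLpNorm w 2 sigma = 1 := by
    rw [eLpNorm_eq_ofReal_norm, hwnorm, ENNReal.ofReal_one]
  refine ⟨w, φ, ⟨Lp.memLp w, ?_, ?_⟩, hφ, ?_⟩
  · intro h
    rw [eLpNorm_congr_ae h, eLpNorm_zero] at hw1
    exact zero_ne_one hw1
  · rw [hw1, mul_one]
    refine le_antisymm ?_ ?_
    · simpa [hw1] using eLpNorm_extension_le (Lp.memLp w)
    · have hbound : ∀ n, eLpNorm (extension (u (φ n))) 6 volume ≤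
          optimalConstant * eLpNorm ((u (φ n) - w : L2Circle) : Circle1 → ℂ) 2 sigma +
            eLpNorm (extension w) 6 volume := by
        intro n
        have hc : ∀ v : L2Circle, AEStronglyMeasurable (extension v) := fun v =>
          (continuous_extension (integrable_of_memLp_two (Lp.memLp v))).aestronglyMeasurable
        have hs : extension (u (φ n)) = extension (u (φ n) - w : L2Circle) + extension w := by
          rw [extension_Lp_sub, sub_add_cancel]
        rw [hs]
        refine (eLpNorm_add_le (hc _) (hc _) (by norm_num)).trans ?_
        gcongr
        exact eLpNorm_extension_le (Lp.memLp _)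
      have hlim := (ENNReal.Tendsto.const_mul (a := optimalConstant) hsub
        (Or.inr optimalConstant_ne_top)).add_const (eLpNorm (extension w) 6 volume)
      rw [mul_zero, zero_add] at hlim
      exact le_of_tendsto_of_tendsto' (hulim.comp hφ.tendsto_atTop) hlim hbound
  · refine hsub.congr fun n => eLpNorm_congr_ae ?_
    filter_upwards [Lp.coeFn_sub (u (φ n)) w, hcoe (φ n)] with x h1 h2
    rw [h1, Pi.sub_apply, Pi.sub_apply, h2]

end TomasStein
end

theorem proposition2p14
    (f : ℕ → TomasStein.Circle1 → ℂ) (hf : TomasStein.IsExtremizingSeq f)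
    (hsymm : ∀ ν, ∀ᵐ x ∂TomasStein.sigma, ‖f ν (-x)‖ = ‖f ν x‖)
    (c : ℕ → TomasStein.Cap) (K : ℝ≥0) (Θ : ℝ → ℝ)
    (hΘpos : ∀ R : ℝ, 1 ≤ R → 0 < Θ R) (hΘ : Tendsto Θ atTop (𝓝 0))
    (hnorm : ∀ ν, TomasStein.UpperEvenNormalized K Θ (c ν) (TomasStein.modulus (f ν))) :
    0 < ⨅ ν, (c ν).radius ∧
    ∃ (F : TomasStein.Circle1 → ℂ) (φ : ℕ → ℕ), TomasStein.IsExtremizer F ∧ StrictMono φ ∧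
      Tendsto (fun n => eLpNorm (TomasStein.modulus (f (φ n)) - F) 2 TomasStein.sigma)
        atTop (𝓝 0) :=
  TomasStein.radius_pos_and_exists_extremizer hf hΘ hnorm
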